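/- Let $U\subseteq\mathbb{R}^q$ be open and let $\mathcal{A}^i=(\mathcal{A}^{\mu i}_\alpha):U\to\mathbb{R}^{m\times q}$, $i=1,\dots,p$, be smooth. Consider the first-order quasilinear system $$\mathcal{A}^{\mu i}_\alpha(u)\,u^\alpha_i=0,\qquad \mu=1,\dots,m,\qquad u^\alpha_i=\partial u^\alpha/\partial x^i,\quad x\in\mathbb{R}^p,\ u\in U\qquad(1)$$ (repeated indices are summed). Let $\lambda^1,\dots,\lambda^k:U\to\mathbb{C}^p$ be smooth wave vectors, i.e. $\operatorname{rank}\big(\lambda^A_i(u)\mathcal{A}^i(u)\big)<\min(m,q)$, such that $\lambda^1(u),\dots,\lambda^k(u),\bar\lambda^1(u),\dots,\bar\lambda^k(u)$ are linearly independent over $\mathbb{C}$ for every $u\in U$. Let $\Lambda(u)\in\mathbb{C}^{2k\times p}$ be the matrix with these $2k$ rows and $\Lambda_i$ its $i$-th column, and let $r^A(x,u)=\lambda^A_i(u)x^i$ be the Riemann invariants. Let $X_a=\xi_a^i(u)\partial_{x^i}$, $a=1,\dots,p-2k$, be vector fields with smooth $\xi_a:U\to\mathbb{C}^p$, pointwise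 linearly independent and orthogonal to the wave vectors: $\lambda^A_i\xi^i_a=\bar\lambda^A_i\xi^i_a=0$. In the space of first jets $(x,u,(u^\alpha_i))$ with $u\in U$ let $S$ be the set of the jets that satisfy (1) and $\xi^i_a(u)u^\alpha_i=0$ for all $a,\alpha$. Assume that (1) is nondegenerate on $S$: at each jet of $S$ the left-hand side of (1) has maximal rank, and each jet of $S$ is the first jet of a local smooth solution of (1). The fields $X_a$ generate a $(p-2k)$-dimensional Abelian conditional symmetry algebra of (1) over $N\subseteq\mathbb{R}^p\times U$ if over $N$ they are linearly independent over $\mathbb{C}$, $[X_a,X_b]=0$, and $\operatorname{pr}^{(1)}X_a(\mathcal{A}^iu_i)=0$ at all jets of $S$ over $N$, where $\operatorname{pr}^{(1)}X_a=X_a-\frac{\partial\xi_a^i}{\partial u^\beta}u^\beta_ju^\alpha_i\frac{\partial}{\partial u^\alpha_j}$. For a smooth function $f(r,\bar r)$ with values in $\mathbb{C}^q$ put $$P=\frac{\partial f}{\partial R}+\frac{\partial\bar f}{\partial R}\in\mathbb{C}^{q\times2k},\qquad R=(r^1,\dots,r^k,\bar r^1,\dots,\bar r^k),\qquad \eta_a=\xi_a^i(u)\frac{\partial\Lambda_i}{\partial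 u}\in\mathbb{C}^{2k\times q},\qquad \mathcal{A}^\mu=(\mathcal{A}^{\mu i}_\alpha)\in\mathbb{R}^{p\times q}.$$ Let $M$ be either of the numbers $q$ and $2k$. (a) Let $(x_0,u_0)\in\mathbb{R}^p\times U$. The following are equivalent: (i) $X_1,\dots,X_{p-2k}$ generate a $(p-2k)$-dimensional Abelian conditional symmetry algebra of (1) over some neighbourhood of $(x_0,u_0)$; (ii) near $(x_0,u_0)$ the system (1) admits a $(p-2k)$-dimensional Abelian conditional symmetry algebra generated by some smooth, pointwise linearly independent fields $\tilde\xi_a^i(u)\partial_{x^i}$ orthogonal to all $\lambda^A,\bar\lambda^A$; (iii) there is a neighbourhood of $(x_0,u_0)$ such that for each jet $(x,u,(u^\alpha_i))\in S$ over it and each smooth $f$ with $f+\bar f=u$ and $P\Lambda(u)=(u^\alpha_i)$ at $r=r(x,u)$, the initial-value condition $$\operatorname{tr}\big(\mathcal{A}^\mu P\Lambda\big)=0,\qquad \mu=1,\dots,m,$$ and the propagation conditions $$\operatorname{tr}\big(\mathcal{A}^\mu P\,\eta_{(a_1}P\,\eta_{a_2}P\cdots\eta_{a_s)}P\,\Lambda\big)=0,\qquad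 \mu=1,\dots,m,\quad 1\le s\le M-1,\quad 1\le a_1,\dots,a_s\le p-2k,$$ hold at this point, where $(a_1\dots a_s)$ denotes symmetrization. (b) Let $u$ be a smooth $U$-valued solution of (1) on an open set containing the origin $x=0$. Its graph is invariant under $X_1,\dots,X_{p-2k}$ near the origin, i.e. $\xi^i_a(u)u^\alpha_i=0$ there, if and only if near the origin $u$ is a $k$-mode solution, i.e. $u=f(r(x,u),\bar r(x,u))+c.c.$ for some smooth $\mathbb{C}^q$-valued function $f$ defined on an open subset of $\mathbb{C}^k$. -/

import Mathlib

open Set Topology Matrix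
open scoped ContDiff

noncomputable section

namespace QuasilinearSystem

/-- First jets `(x, u, L)` of maps from `ℝ^p` to `ℝ^q`; the entry `L α i` is the coordinate
`u^α_i`, which stands for `∂u^α/∂x^i`. -/
abbrev Jet (p q : ℕ) : Type :=
  (Fin p → ℝ) × (Fin q → ℝ) × (Fin q → Fin p → ℝ)

/-- The partial derivative `∂g/∂u^β` of a complex-valued function `g` of the dependent
variables. -/
def partialU {q : ℕ} (g : (Fin q → ℝ) → ℂ) (β : Fin q) (u : Fin q → ℝ) : ℂ :=
  fderiv ℝ g u (Pi.single β 1)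

/-! ### The system and its solutions -/

/-- The left-hand side `Δ^μ = ∑_i ∑_α A^{μ i}_α(u) u^α_i` of the system, as a function on the
first jet space. The coefficient `A^{μ i}_α(u)` is `A i u μ α`. -/
def systemMap {p q m : ℕ} (A : Fin p → (Fin q → ℝ) → Matrix (Fin m) (Fin q) ℝ)
    (z : Jet p q) : Fin m → ℝ :=
  fun μ => ∑ i, ∑ α, A i z.2.1 μ α * z.2.2 α i

/-- The first jet of the map `u` at the point `x`. -/
def jetOf {p q : ℕ} (u : (Fin p → ℝ) → (Fin q → ℝ)) (x : Fin p → ℝ) : Jet p q :=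
  (x, u x, fun α i => fderiv ℝ u x (Pi.single i 1) α)

/-- `u` is a smooth solution of `A^i(u) u_i = 0` on the set `D`, with values in `U`. -/
structure IsSolutionOn {p q m : ℕ} (A : Fin p → (Fin q → ℝ) → Matrix (Fin m) (Fin q) ℝ)
    (U : Set (Fin q → ℝ)) (u : (Fin p → ℝ) → (Fin q → ℝ)) (D : Set (Fin p → ℝ)) : Prop where
  smooth : ContDiffOn ℝ ∞ u D
  mapsTo : MapsTo u D U
  equation : ∀ x ∈ D, systemMap A (jetOf u x) = 0

/-- The subset of the jet space (over `U`) defined by the system. -/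
def SDelta {p q m : ℕ} (A : Fin p → (Fin q → ℝ) → Matrix (Fin m) (Fin q) ℝ)
    (U : Set (Fin q → ℝ)) : Set (Jet p q) :=
  {z | z.2.1 ∈ U ∧ systemMap A z = 0}

/-- The subset of the jet space defined by the invariance conditions `ξ_a^i(u) u^α_i = 0`. -/
def SQ {p q n : ℕ} (ξ : Fin n → (Fin q → ℝ) → (Fin p → ℂ)) : Set (Jet p q) :=
  {z | ∀ (a : Fin n) (α : Fin q), ∑ i, ξ a z.2.1 i * (z.2.2 α i : ℂ) = 0}

/-- The system is nondegenerate at the jet `z`: it is of maximal rank there, and it is locally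
solvable there, that is, `z` is the first jet of a local smooth solution. -/
structure IsNondegenerateAt {p q m : ℕ}
    (A : Fin p → (Fin q → ℝ) → Matrix (Fin m) (Fin q) ℝ)
    (U : Set (Fin q → ℝ)) (z : Jet p q) : Prop where
  maximalRank : Function.Surjective (fderiv ℝ (systemMap A) z)
  locallySolvable : ∃ (D : Set (Fin p → ℝ)) (u : (Fin p → ℝ) → (Fin q → ℝ)),
    IsOpen D ∧ z.1 ∈ D ∧ IsSolutionOn A U u D ∧ jetOf u z.1 = z

/-! ### Wave vectors, Riemann invariants and orthogonal vector fields -/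

/-- The `2k × p` matrix `Λ(u)` whose rows are `λ^1, …, λ^k` followed by their conjugates. -/
def waveMatrix {p q k : ℕ} (lam : Fin k → (Fin q → ℝ) → (Fin p → ℂ)) (u : Fin q → ℝ) :
    Matrix (Fin k ⊕ Fin k) (Fin p) ℂ :=
  Matrix.of (Sum.elim (fun B i => lam B u i) (fun B i => star (lam B u i)))

/-- `λ^1, …, λ^k` are smooth complex wave vectors of the system on `U`: they satisfy the
dispersion relation `rank (λ_i A^i(u)) < min (m, q)`, and together with their complex conjugates
they are linearly independent over `ℂ`. -/
structure IsWaveSystem {p q m k : ℕ} (A : Fin p → (Fin q → ℝ) → Matrix (Fin m) (Fin q) ℝ)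
    (lam : Fin k → (Fin q → ℝ) → (Fin p → ℂ)) (U : Set (Fin q → ℝ)) : Prop where
  smooth : ∀ B, ContDiffOn ℝ ∞ (lam B) U
  dispersion : ∀ u ∈ U, ∀ B,
    (∑ i, lam B u i • (A i u).map (fun t : ℝ => (t : ℂ))).rank < min m q
  independent : ∀ u ∈ U, LinearIndependent ℂ (fun s => waveMatrix lam u s)

/-- The Riemann invariants `r^B(x, u) = λ^B_i(u) x^i`. -/
def riemannInvariant {p q k : ℕ} (lam : Fin k → (Fin q → ℝ) → (Fin p → ℂ))
    (x : Fin p → ℝ) (u : Fin q → ℝ) : Fin k → ℂ :=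
  fun B => ∑ i, lam B u i * (x i : ℂ)

/-- The fields `ξ_1, …, ξ_n` are smooth on `U`, linearly independent at each point, and
orthogonal to all `λ^B` and to all their conjugates. -/
structure IsOrthogonalFrame {p q k n : ℕ} (lam : Fin k → (Fin q → ℝ) → (Fin p → ℂ))
    (ξ : Fin n → (Fin q → ℝ) → (Fin p → ℂ)) (U : Set (Fin q → ℝ)) : Prop where
  smooth : ∀ a, ContDiffOn ℝ ∞ (ξ a) U
  independent : ∀ u ∈ U, LinearIndependent ℂ (fun a => ξ a u)
  orthogonal : ∀ u ∈ U, ∀ B a, ∑ i, lam B u i * ξ a u i = 0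
  orthogonal_conj : ∀ u ∈ U, ∀ B a, ∑ i, star (lam B u i) * ξ a u i = 0

/-! ### Conditional symmetry algebras -/

/-- A vector field on `X × U` with complex coefficients. -/
abbrev CField (p q : ℕ) : Type :=
  (Fin p → ℝ) × (Fin q → ℝ) → (Fin p → ℂ) × (Fin q → ℂ)

/-- The field `X_a = ξ_a^i(u) ∂/∂x^i`. -/
def fieldX {p q n : ℕ} (ξ : Fin n → (Fin q → ℝ) → (Fin p → ℂ)) (a : Fin n) : CField p q :=
  fun y => (ξ a y.2, 0)

/-- The value at `y` of `V(g)`, for a complex vector field `V` and a function `g` on `X × U`. -/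
def applyField {p q : ℕ} (V : CField p q) (g : (Fin p → ℝ) × (Fin q → ℝ) → ℂ)
    (y : (Fin p → ℝ) × (Fin q → ℝ)) : ℂ :=
  ∑ i, (V y).1 i * fderiv ℝ g y (Pi.single i 1, 0)
    + ∑ α, (V y).2 α * fderiv ℝ g y (0, Pi.single α 1)

/-- The Lie bracket of two complex vector fields on `X × U`. -/
def bracket {p q : ℕ} (V W : CField p q) : CField p q :=
  fun y =>
    (fun i => applyField V (fun t => (W t).1 i) y - applyField W (fun t => (V t).1 i) y,
     fun α => applyField V (fun t => (W t).2 α) y - applyField W (fun t => (V t).2 α) y)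

/-- The action on a function `F` on the jet space of the first prolongation
`pr X_a = ξ_a^i ∂/∂x^i - (∂ξ_a^i/∂u^β) u^β_j u^α_i ∂/∂u^α_j`. -/
def prolongation {p q n : ℕ} (ξ : Fin n → (Fin q → ℝ) → (Fin p → ℂ)) (a : Fin n)
    (F : Jet p q → ℝ) (z : Jet p q) : ℂ :=
  ∑ i, ξ a z.2.1 i * (fderiv ℝ F z (Pi.single i 1, 0, 0) : ℂ)
    - ∑ α, ∑ j,
      (∑ i, ∑ β, partialU (fun u => ξ a u i) β z.2.1 * (z.2.2 β j : ℂ) * (z.2.2 α i : ℂ))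
        * (fderiv ℝ F z (0, 0, Pi.single α (Pi.single j 1)) : ℂ)

/-- Over the set `N ⊆ X × U`, the fields `X_1, …, X_n` span an `n`-dimensional Abelian Lie
algebra, and it is a conditional symmetry algebra of the system: `pr X_a (A^i u_i)` vanishes at
all the jets over `N` that satisfy both the system and the invariance conditions. -/
structure IsConditionalSymmetryAlgebraOn {p q m n : ℕ}
    (A : Fin p → (Fin q → ℝ) → Matrix (Fin m) (Fin q) ℝ) (U : Set (Fin q → ℝ))
    (ξ : Fin n → (Fin q → ℝ) → (Fin p → ℂ)) (N : Set ((Fin p → ℝ) × (Fin q → ℝ))) : Prop where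
  dimension : LinearIndependent ℂ (fun (a : Fin n) (y : N) => fieldX ξ a y)
  abelian : ∀ a b, ∀ y ∈ N, bracket (fieldX ξ a) (fieldX ξ b) y = 0
  symmetric : ∀ z ∈ SDelta A U ∩ SQ ξ, (z.1, z.2.1) ∈ N →
    ∀ a μ, prolongation ξ a (fun w => systemMap A w μ) z = 0

/-- The fields `X_a` generate an `n`-dimensional Abelian conditional symmetry algebra on some
neighbourhood of `y₀ = (x₀, u₀)`. -/
def GeneratesSymmetryAlgebraNear {p q m n : ℕ}
    (A : Fin p → (Fin q → ℝ) → Matrix (Fin m) (Fin q) ℝ) (U : Set (Fin q → ℝ))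
    (ξ : Fin n → (Fin q → ℝ) → (Fin p → ℂ)) (y₀ : (Fin p → ℝ) × (Fin q → ℝ)) : Prop :=
  ∃ N ∈ 𝓝 y₀, N ⊆ univ ×ˢ U ∧ IsConditionalSymmetryAlgebraOn A U ξ N

/-- Near `y₀ = (x₀, u₀)` the system admits a `(p - 2k)`-dimensional Abelian conditional symmetry
algebra generated by some fields `ξ_a^i(u) ∂/∂x^i` orthogonal to the wave vectors and their
conjugates. -/
def AdmitsSymmetryAlgebraNear {p q m k : ℕ}
    (A : Fin p → (Fin q → ℝ) → Matrix (Fin m) (Fin q) ℝ)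
    (lam : Fin k → (Fin q → ℝ) → (Fin p → ℂ)) (U : Set (Fin q → ℝ))
    (y₀ : (Fin p → ℝ) × (Fin q → ℝ)) : Prop :=
  ∃ (U' : Set (Fin q → ℝ)) (ξ : Fin (p - 2 * k) → (Fin q → ℝ) → (Fin p → ℂ)),
    IsOpen U' ∧ y₀.2 ∈ U' ∧ U' ⊆ U ∧ IsOrthogonalFrame lam ξ U' ∧
      GeneratesSymmetryAlgebraNear A U' ξ y₀

/-! ### The trace conditions -/

/-- The `q × 2k` matrix `∂f/∂R = (∂f/∂r, ∂f/∂r̄)` of the Wirtinger derivatives of a function `f`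
of the complex variables `r^1, …, r^k`. -/
def derivR {q k : ℕ} (f : (Fin k → ℂ) → (Fin q → ℂ)) (r : Fin k → ℂ) :
    Matrix (Fin q) (Fin k ⊕ Fin k) ℂ :=
  Matrix.of fun α => Sum.elim
    (fun B => (fderiv ℝ f r (Pi.single B 1) α
      - Complex.I * fderiv ℝ f r (Pi.single B Complex.I) α) / 2)
    (fun B => (fderiv ℝ f r (Pi.single B 1) α
      + Complex.I * fderiv ℝ f r (Pi.single B Complex.I) α) / 2)

/-- The matrix `∂f/∂R + ∂f̄/∂R`. -/
def profileMatrix {q k : ℕ} (f : (Fin k → ℂ) → (Fin q → ℂ)) (r : Fin k → ℂ) :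
    Matrix (Fin q) (Fin k ⊕ Fin k) ℂ :=
  derivR f r + derivR (fun t => star (f t)) r

/-- The `p × q` matrix `A^μ = (A^{μ i}_α(u))`. -/
def coeffMatrix {p q m : ℕ} (A : Fin p → (Fin q → ℝ) → Matrix (Fin m) (Fin q) ℝ) (μ : Fin m)
    (u : Fin q → ℝ) : Matrix (Fin p) (Fin q) ℂ :=
  Matrix.of fun i α => (A i u μ α : ℂ)

/-- The `2k × q` matrix `η_a = ξ_a^i(u) ∂Λ_i/∂u`, the derivative of `∂R/∂u = (∂Λ_i/∂u) x^i` along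
`X_a`. When `2k` columns of `Λ` form the identity matrix and `X_a` is the field
`∂/∂x^{i_a} - (combination of the ∂/∂x^i of these columns)`, it is `∂Λ_{i_a}/∂u`. -/
def etaMatrix {p q k n : ℕ} (lam : Fin k → (Fin q → ℝ) → (Fin p → ℂ))
    (ξ : Fin n → (Fin q → ℝ) → (Fin p → ℂ)) (a : Fin n) (u : Fin q → ℝ) :
    Matrix (Fin k ⊕ Fin k) (Fin q) ℂ :=
  Matrix.of fun s β => ∑ i, ξ a u i * partialU (fun v => waveMatrix lam v s i) β u

/-- The initial-value condition `tr (A^μ (∂f/∂R + ∂f̄/∂R) Λ) = 0` for all `μ`, with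
`P = ∂f/∂R + ∂f̄/∂R`. -/
def InitialCondition {p q m k : ℕ} (A : Fin p → (Fin q → ℝ) → Matrix (Fin m) (Fin q) ℝ)
    (lam : Fin k → (Fin q → ℝ) → (Fin p → ℂ)) (u : Fin q → ℝ)
    (P : Matrix (Fin q) (Fin k ⊕ Fin k) ℂ) : Prop :=
  ∀ μ, (coeffMatrix A μ u * P * waveMatrix lam u).trace = 0

/-- The propagation condition of order `s`:
`tr (A^μ P η_{(a_1} P η_{a_2} P … η_{a_s)} P Λ) = 0` for all `μ` and `a_1, …, a_s`, with the
indices symmetrized and `P = ∂f/∂R + ∂f̄/∂R`. -/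
def PropagationCondition {p q m k n : ℕ} (A : Fin p → (Fin q → ℝ) → Matrix (Fin m) (Fin q) ℝ)
    (lam : Fin k → (Fin q → ℝ) → (Fin p → ℂ)) (ξ : Fin n → (Fin q → ℝ) → (Fin p → ℂ))
    (u : Fin q → ℝ) (P : Matrix (Fin q) (Fin k ⊕ Fin k) ℂ) (s : ℕ) : Prop :=
  ∀ μ, ∀ a : Fin s → Fin n,
    ∑ σ : Equiv.Perm (Fin s),
      (coeffMatrix A μ u * (List.ofFn fun j => P * etaMatrix lam ξ (a (σ j)) u).prod
        * P * waveMatrix lam u).trace = 0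

/-- On some neighbourhood of `y₀ = (x₀, u₀)` the trace conditions hold along the jets `(x, u, L)`
which satisfy the system and the invariance conditions: for each smooth `f` with
`f(r) + c.c. = u` and `(∂f/∂R + ∂f̄/∂R) Λ(u) = L` at `r = r(x, u)`, the initial-value condition
and the propagation conditions of the orders `1 ≤ s ≤ M - 1` hold. -/
def TraceConditionsNear {p q m k n : ℕ} (M : ℕ)
    (A : Fin p → (Fin q → ℝ) → Matrix (Fin m) (Fin q) ℝ)
    (lam : Fin k → (Fin q → ℝ) → (Fin p → ℂ)) (U : Set (Fin q → ℝ))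
    (ξ : Fin n → (Fin q → ℝ) → (Fin p → ℂ)) (y₀ : (Fin p → ℝ) × (Fin q → ℝ)) : Prop :=
  ∃ N ∈ 𝓝 y₀, N ⊆ univ ×ˢ U ∧
    ∀ z ∈ SDelta A U ∩ SQ ξ, (z.1, z.2.1) ∈ N →
      ∀ f : (Fin k → ℂ) → (Fin q → ℂ),
        ContDiffAt ℝ ∞ f (riemannInvariant lam z.1 z.2.1) →
        (∀ α, (z.2.1 α : ℂ) = f (riemannInvariant lam z.1 z.2.1) α
          + star (f (riemannInvariant lam z.1 z.2.1) α)) →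
        profileMatrix f (riemannInvariant lam z.1 z.2.1) * waveMatrix lam z.2.1
          = Matrix.of (fun α i => (z.2.2 α i : ℂ)) →
        InitialCondition A lam z.2.1 (profileMatrix f (riemannInvariant lam z.1 z.2.1)) ∧
        ∀ s, 1 ≤ s → s < M → PropagationCondition A lam ξ z.2.1
          (profileMatrix f (riemannInvariant lam z.1 z.2.1)) s

/-! ### Invariant maps and multimode maps -/

/-- The graph of `u` over `V` is invariant under the fields `X_a`: the vector `(ξ_a(u(x)), 0)` is
tangent to the graph at `(x, u(x))`, that is, `ξ_a^i(u) ∂u^α/∂x^i = 0` on `V`. -/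
def IsInvariantOn {p q n : ℕ} (ξ : Fin n → (Fin q → ℝ) → (Fin p → ℂ))
    (u : (Fin p → ℝ) → (Fin q → ℝ)) (V : Set (Fin p → ℝ)) : Prop :=
  ∀ x ∈ V, jetOf u x ∈ SQ ξ

/-- On `V` the map `u` is of the form `u = f(r(x,u), r̄(x,u)) + c.c.` with a smooth function `f`
(smooth in the real sense, so that it is a function of `r` and `r̄`). -/
def IsModeFormOn {p q k : ℕ} (lam : Fin k → (Fin q → ℝ) → (Fin p → ℂ))
    (u : (Fin p → ℝ) → (Fin q → ℝ)) (V : Set (Fin p → ℝ)) : Prop :=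
  ∃ (O : Set (Fin k → ℂ)) (f : (Fin k → ℂ) → (Fin q → ℂ)), IsOpen O ∧ ContDiffOn ℝ ∞ f O ∧
    ∀ x ∈ V, riemannInvariant lam x (u x) ∈ O ∧
      ∀ α, (u x α : ℂ) = f (riemannInvariant lam x (u x)) α
        + star (f (riemannInvariant lam x (u x)) α)

end QuasilinearSystem

end

/-! Part (a) is linear algebra at each fixed `u`. Orthogonality to the frame means that a real
gradient `L` has its rows in the span of the wave vectors and their conjugates, so `L = P Λ` for
exactly one `P`, which is real in the sense that it is fixed by `conjProfile`. The jets of `S` over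
`u` are thus the real elements `P` of the complex subspace `solutionProfiles` (called W here), cut
out by `tr (A^μ Q Λ) = 0`. Differentiating `Λ ξ_a = 0` turns the prolongation at such a jet into `tr
(A^μ P η_a P Λ)` (`prolongation_systemMap`). The symmetry condition therefore says that `P η_a P`
stays in W for every real `P` in W; this is `IsStableAt`, and it does not mention `x`.

All three statements of (a) reduce to stability on a neighbourhood. The order-one propagation
condition is stability, since affine profiles realize every real `P`. Conversely, stability
polarizes to closure of W under `P η_a Q + Q η_a P`, and symmetrized words of every order are built
from these products (`symWord_mem`), so all higher conditions follow. Independence and commutation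
of the fields are automatic, and stability is the same for every orthogonal frame
(`IsStableAt.of_frame`).

For (b), write `r(x) = r(x, u(x))`, so `dr = Λ + (x^i ∂Λ_i/∂u) du`, with only the λ rows of `Λ`
taken, and invariance says that `du` vanishes on the real kernel of those rows. If so, that kernel
equals `ker dr` near the origin, and `u` factors through the submersion `r`
(`exists_factor_through_submersion`). If instead `u = g(r)`, then on that kernel `du = C du` with `C
= dg (x^i ∂Λ_i/∂u)`; since `C` is zero at `x = 0` and small nearby, `du` vanishes there. -/

noncomputable section

namespace QuasilinearSystem

/-! ### Linear algebra -/

/-- A linearly independent family of rows `c` has an orthogonal complement spanned by any linearly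
independent family of complementary size which is orthogonal to it. -/
theorem mem_span_of_orthogonal {ι κ : Type*} [Fintype ι] [Fintype κ] {p : ℕ}
    {b : ι → Fin p → ℂ} {c : κ → Fin p → ℂ} (hb : LinearIndependent ℂ b)
    (hc : LinearIndependent ℂ c) (hcard : Fintype.card ι + Fintype.card κ = p)
    (hbc : ∀ i j, ∑ l, c j l * b i l = 0) {v : Fin p → ℂ} (hv : ∀ j, ∑ l, c j l * v l = 0) :
    ∃ t : ι → ℂ, ∑ i, t i • b i = v := by
  classical
  set K : Submodule ℂ (Fin p → ℂ) := LinearMap.ker (Matrix.of c).mulVecLin with hK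
  have hle : Submodule.span ℂ (Set.range b) ≤ K := by
    rw [Submodule.span_le]
    rintro _ ⟨i, rfl⟩
    simp only [hK, SetLike.mem_coe, LinearMap.mem_ker, Matrix.mulVecLin_apply]
    ext j
    exact hbc i j
  have hrank : (Matrix.of c).rank = Fintype.card κ := by
    have : LinearIndependent ℂ (Matrix.of c).row := hc
    exact this.rank_matrix
  have h1 : Module.finrank ℂ (LinearMap.range (Matrix.of c).mulVecLin) + Module.finrank ℂ K = p := by
    rw [hK, LinearMap.finrank_range_add_finrank_ker]; simp
  have h2 : Module.finrank ℂ (Submodule.span ℂ (Set.range b)) = Fintype.card ι :=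
    finrank_span_eq_card hb
  have heq : Submodule.span ℂ (Set.range b) = K := by
    apply Submodule.eq_of_le_of_finrank_eq hle
    rw [Matrix.rank] at hrank
    omega
  have hvK : v ∈ K := by
    simp only [hK, LinearMap.mem_ker, Matrix.mulVecLin_apply]
    ext j
    exact hv j
  rw [← heq] at hvK
  exact (Submodule.mem_span_range_iff_exists_fun ℂ).1 hvK

/-- Independence of the `2k` rows forces `2 * k ≤ p`, so the natural-number subtraction is not
truncated. -/
theorem card_sum_add_sub {p k : ℕ} {c : Fin k ⊕ Fin k → Fin p → ℂ}
    (hc : LinearIndependent ℂ c) :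
    Fintype.card (Fin (p - 2 * k)) + Fintype.card (Fin k ⊕ Fin k) = p := by
  have := hc.fintype_card_le_finrank
  simp at this ⊢
  omega

/-! ### Symmetrized words -/

/-- A permutation of `Fin (s + 1)` amounts to the image `j` of `i₀` and a permutation of the
remaining `s` indices. -/
theorem bijective_permSuccAbove {s : ℕ} (i₀ : Fin (s + 1)) :
    Function.Bijective (fun t : Fin (s + 1) × Equiv.Perm (Fin s) =>
      ((finSuccEquiv' i₀).trans ((Equiv.optionCongr t.2).trans (finSuccEquiv' t.1).symm) :
        Equiv.Perm (Fin (s + 1)))) := by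
  rw [Fintype.bijective_iff_injective_and_card]
  constructor
  · rintro ⟨j, τ⟩ ⟨j', τ'⟩ h
    have h0 := congrArg (fun e : Equiv.Perm (Fin (s + 1)) => e i₀) h
    simp at h0
    subst h0
    have h1 : τ = τ' := by
      ext i
      have := congrArg (fun e : Equiv.Perm (Fin (s + 1)) => e (i₀.succAbove i)) h
      simp at this
      rw [this]
    rw [h1]
  · simp [Fintype.card_perm, Nat.factorial_succ]

/-- The permutations are grouped by the letter placed in slot `i₀`. Taking the first or the last
slot peels a letter off either end of a symmetrized word. -/
theorem sum_perm_succ {M : Type*} [AddCommMonoid M] {n s : ℕ} (i₀ : Fin (s + 1))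
    (a : Fin (s + 1) → Fin n) (g : (Fin (s + 1) → Fin n) → M) :
    ∑ σ : Equiv.Perm (Fin (s + 1)), g (fun j => a (σ j))
      = ∑ j, ∑ τ : Equiv.Perm (Fin s),
          g (i₀.insertNth (a j) (fun i => a (j.succAbove (τ i)))) := by
  rw [← Fintype.sum_prod_type' (f := fun j (τ : Equiv.Perm (Fin s)) =>
    g (i₀.insertNth (a j) (fun i => a (j.succAbove (τ i)))))]
  refine (Fintype.sum_bijective _ (bijective_permSuccAbove i₀) _ _ ?_).symm
  rintro ⟨j, τ⟩
  congr 1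
  funext i
  refine Fin.succAboveCases i₀ ?_ ?_ i
  · simp
  · intro i
    simp

/-- The symmetrized word `∑_σ P η_{a_σ(1)} P ⋯ η_{a_σ(s)} P`. -/
def symWord {ι κ : Type*} [Fintype ι] [Fintype κ] [DecidableEq ι] {n s : ℕ}
    (P : Matrix ι κ ℂ) (η : Fin n → Matrix κ ι ℂ)
    (a : Fin s → Fin n) : Matrix ι κ ℂ :=
  ∑ σ : Equiv.Perm (Fin s), (List.ofFn fun j => P * η (a (σ j))).prod * P

theorem symWord_succ_left {ι κ : Type*} [Fintype ι] [Fintype κ] [DecidableEq ι] {n s : ℕ}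
    (P : Matrix ι κ ℂ) (η : Fin n → Matrix κ ι ℂ) (a : Fin (s + 1) → Fin n) :
    symWord P η a = ∑ j, P * η (a j) * symWord P η (fun i => a (j.succAbove i)) := by
  rw [symWord, sum_perm_succ 0 a (fun b => (List.ofFn fun j => P * η (b j)).prod * P)]
  simp [symWord, Matrix.mul_sum, Matrix.mul_assoc]

theorem symWord_succ_right {ι κ : Type*} [Fintype ι] [Fintype κ] [DecidableEq ι] {n s : ℕ}
    (P : Matrix ι κ ℂ) (η : Fin n → Matrix κ ι ℂ) (a : Fin (s + 1) → Fin n) :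
    symWord P η a = ∑ j, symWord P η (fun i => a (j.succAbove i)) * η (a j) * P := by
  rw [symWord, sum_perm_succ (Fin.last s) a (fun b => (List.ofFn fun j => P * η (b j)).prod * P)]
  simp only [symWord, List.ofFn_succ', List.concat_eq_append, List.prod_append, List.prod_singleton,
    Fin.insertNth_last', Fin.snoc_castSucc, Fin.snoc_last, Matrix.sum_mul, Matrix.mul_assoc]

/-- A subspace closed under all the maps `P ↦ P η_a P` contains the symmetrized words in its
elements. -/
theorem symWord_mem {ι κ : Type*} [Fintype ι] [Fintype κ] [DecidableEq ι] {n : ℕ}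
    (W : Submodule ℂ (Matrix ι κ ℂ)) (η : Fin n → Matrix κ ι ℂ)
    (hW : ∀ P ∈ W, ∀ Q ∈ W, ∀ a, P * η a * Q + Q * η a * P ∈ W) {P : Matrix ι κ ℂ} (hP : P ∈ W)
    (s : ℕ) (a : Fin s → Fin n) : symWord P η a ∈ W := by
  induction s with
  | zero => simpa [symWord] using hP
  | succ s ih =>
    -- One copy of the word is expanded from the left and the other from the right. The terms pair
    -- up as `P η Q + Q η P`, where `Q` is a shorter symmetrized word.
    have h2 : (2 : ℂ) • symWord P η a ∈ W := by
      rw [two_smul]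
      nth_rewrite 1 [symWord_succ_left]
      rw [symWord_succ_right, ← Finset.sum_add_distrib]
      exact W.sum_mem fun j _ => hW _ hP _ (ih _) _
    exact (W.smul_mem_iff two_ne_zero).1 h2

/-! ### Real jets and profile matrices -/

section Pointwise

variable {p q m k n : ℕ} {A : Fin p → (Fin q → ℝ) → Matrix (Fin m) (Fin q) ℝ}
  {lam : Fin k → (Fin q → ℝ) → (Fin p → ℂ)} {ξ : Fin n → (Fin q → ℝ) → (Fin p → ℂ)}
  {U : Set (Fin q → ℝ)} {u : Fin q → ℝ}

/-- Conjugation exchanges the two halves of the rows; this is the origin of the swap in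
`conjProfile`. -/
theorem star_waveMatrix (lam : Fin k → (Fin q → ℝ) → (Fin p → ℂ)) (u : Fin q → ℝ)
    (s : Fin k ⊕ Fin k) (i : Fin p) :
    star (waveMatrix lam u s i) = waveMatrix lam u s.swap i := by
  rcases s with B | B <;> simp [waveMatrix]

theorem IsOrthogonalFrame.waveMatrix_orthogonal (hξ : IsOrthogonalFrame lam ξ U) (hu : u ∈ U)
    (s : Fin k ⊕ Fin k) (a : Fin n) : ∑ i, waveMatrix lam u s i * ξ a u i = 0 := by
  rcases s with B | B
  · exact hξ.orthogonal u hu B a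
  · exact hξ.orthogonal_conj u hu B a

/-- The conjugation on the profile matrices which corresponds to entrywise conjugation of
`P Λ`. -/
def conjProfile (P : Matrix (Fin q) (Fin k ⊕ Fin k) ℂ) : Matrix (Fin q) (Fin k ⊕ Fin k) ℂ :=
  Matrix.of fun α s => star (P α s.swap)

theorem conjProfile_mul_waveMatrix (P : Matrix (Fin q) (Fin k ⊕ Fin k) ℂ)
    (α : Fin q) (i : Fin p) :
    (conjProfile P * waveMatrix lam u) α i = star ((P * waveMatrix lam u) α i) := by
  rw [Matrix.mul_apply, Matrix.mul_apply, star_sum]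
  refine Fintype.sum_equiv (Equiv.sumComm _ _) _ _ fun s => ?_
  simp only [conjProfile, Matrix.of_apply, Equiv.sumComm_apply, star_mul', star_waveMatrix,
    Sum.swap_swap]

theorem mul_waveMatrix_injective (hΛ : LinearIndependent ℂ (fun s => waveMatrix lam u s))
    {P Q : Matrix (Fin q) (Fin k ⊕ Fin k) ℂ} (h : P * waveMatrix lam u = Q * waveMatrix lam u) :
    P = Q := by
  have hli : LinearIndependent ℂ (waveMatrix lam u).row := hΛ
  have hinj := Matrix.vecMul_injective_iff.2 hli
  ext α s
  refine congrFun (hinj (a₁ := P α) (a₂ := Q α) ?_) s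
  ext i
  exact congrFun (congrFun h α) i

/-- `P Λ` is a real matrix. -/
def IsRealProfile (lam : Fin k → (Fin q → ℝ) → (Fin p → ℂ)) (u : Fin q → ℝ)
    (P : Matrix (Fin q) (Fin k ⊕ Fin k) ℂ) : Prop :=
  ∃ L : Fin q → Fin p → ℝ, P * waveMatrix lam u = Matrix.of fun α i => (L α i : ℂ)

theorem IsRealProfile.conj_eq (hΛ : LinearIndependent ℂ (fun s => waveMatrix lam u s))
    {P : Matrix (Fin q) (Fin k ⊕ Fin k) ℂ} (hP : IsRealProfile lam u P) : conjProfile P = P := by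
  obtain ⟨L, hL⟩ := hP
  refine mul_waveMatrix_injective hΛ ?_
  ext α i
  rw [conjProfile_mul_waveMatrix, hL]
  simp

theorem isRealProfile_of_conj_eq {P : Matrix (Fin q) (Fin k ⊕ Fin k) ℂ}
    (hP : conjProfile P = P) : IsRealProfile lam u P := by
  refine ⟨fun α i => ((P * waveMatrix lam u) α i).re, ?_⟩
  ext α i
  have h := conjProfile_mul_waveMatrix (lam := lam) (u := u) P α i
  rw [hP] at h
  exact (Complex.conj_eq_iff_re.1 h.symm).symm

/-- The complement of the frame has dimension `2k` and contains the independent rows of `Λ`, hence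
is their span; this applies to each row of `L`. -/
theorem exists_profile {ξ : Fin (p - 2 * k) → (Fin q → ℝ) → (Fin p → ℂ)}
    (hΛ : LinearIndependent ℂ (fun s => waveMatrix lam u s))
    (hξ : IsOrthogonalFrame lam ξ U) (hu : u ∈ U) {L : Fin q → Fin p → ℝ}
    (hL : ∀ a α, ∑ i, ξ a u i * (L α i : ℂ) = 0) :
    ∃ P : Matrix (Fin q) (Fin k ⊕ Fin k) ℂ,
      P * waveMatrix lam u = Matrix.of fun α i => (L α i : ℂ) := by
  have key : ∀ α, ∃ t : Fin k ⊕ Fin k → ℂ,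
      ∑ s, t s • waveMatrix lam u s = fun i => (L α i : ℂ) := fun α =>
    mem_span_of_orthogonal hΛ (hξ.independent u hu)
      (by rw [add_comm]; exact card_sum_add_sub hΛ)
      (fun s a => by
        rw [← hξ.waveMatrix_orthogonal hu s a]
        exact Finset.sum_congr rfl fun _ _ => mul_comm _ _)
      (fun a => hL a α)
  choose P hP using key
  refine ⟨Matrix.of P, ?_⟩
  ext α i
  have := congrFun (hP α) i
  simpa [Matrix.mul_apply, Finset.sum_apply] using this

/-- A matrix whose rows are combinations of the wave vectors satisfies the invariance
conditions. -/
theorem sum_mul_eq_zero_of_profile (hξ : IsOrthogonalFrame lam ξ U) (hu : u ∈ U)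
    {P : Matrix (Fin q) (Fin k ⊕ Fin k) ℂ} {L : Fin q → Fin p → ℝ}
    (hL : P * waveMatrix lam u = Matrix.of fun α i => (L α i : ℂ)) (a : Fin n) (α : Fin q) :
    ∑ i, ξ a u i * (L α i : ℂ) = 0 := by
  have h1 : ∀ i, (L α i : ℂ) = ∑ s, P α s * waveMatrix lam u s i := fun i => by
    have := congrFun (congrFun hL α) i
    rw [Matrix.mul_apply] at this
    exact this.symm
  simp_rw [h1, Finset.mul_sum]
  rw [Finset.sum_comm]
  refine Finset.sum_eq_zero fun s _ => ?_
  rw [← mul_zero (P α s), ← hξ.waveMatrix_orthogonal hu s a, Finset.mul_sum]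
  exact Finset.sum_congr rfl fun i _ => by ring

/-! ### The system on profile matrices -/

/-- The profile matrices `Q` with `tr (A^μ Q Λ) = 0` for all `μ`. -/
def solutionProfiles (A : Fin p → (Fin q → ℝ) → Matrix (Fin m) (Fin q) ℝ)
    (lam : Fin k → (Fin q → ℝ) → (Fin p → ℂ)) (u : Fin q → ℝ) :
    Submodule ℂ (Matrix (Fin q) (Fin k ⊕ Fin k) ℂ) where
  carrier := {Q | InitialCondition A lam u Q}
  add_mem' := fun {P Q} hP hQ μ => by
    rw [Matrix.mul_add, Matrix.add_mul, Matrix.trace_add, hP μ, hQ μ, add_zero]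
  zero_mem' := fun μ => by simp
  smul_mem' := fun c Q hQ μ => by
    rw [Matrix.mul_smul, Matrix.smul_mul, Matrix.trace_smul, hQ μ, smul_zero]

theorem mem_solutionProfiles {P : Matrix (Fin q) (Fin k ⊕ Fin k) ℂ} :
    P ∈ solutionProfiles A lam u ↔
      ∀ μ, (coeffMatrix A μ u * P * waveMatrix lam u).trace = 0 := Iff.rfl

theorem trace_coeffMatrix_mul (μ : Fin m) (Q : Matrix (Fin q) (Fin p) ℂ) :
    (coeffMatrix A μ u * Q).trace = ∑ i, ∑ α, (A i u μ α : ℂ) * Q α i := by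
  simp [Matrix.trace, Matrix.mul_apply, coeffMatrix]

/-- The coefficients of the system are real, so conjugating the trace equation only conjugates `P
Λ`. -/
theorem conjProfile_mem {P : Matrix (Fin q) (Fin k ⊕ Fin k) ℂ}
    (hP : P ∈ solutionProfiles A lam u) : conjProfile P ∈ solutionProfiles A lam u := by
  rw [mem_solutionProfiles] at hP ⊢
  intro μ
  have h := congrArg star (hP μ)
  rw [Matrix.mul_assoc, trace_coeffMatrix_mul] at h ⊢
  simp_rw [conjProfile_mul_waveMatrix]
  simpa using h

theorem mem_solutionProfiles_iff_systemMap {P : Matrix (Fin q) (Fin k ⊕ Fin k) ℂ}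
    {L : Fin q → Fin p → ℝ} (x : Fin p → ℝ)
    (hL : P * waveMatrix lam u = Matrix.of fun α i => (L α i : ℂ)) :
    P ∈ solutionProfiles A lam u ↔ systemMap A (x, u, L) = 0 := by
  rw [mem_solutionProfiles, funext_iff]
  refine forall_congr' fun μ => ?_
  rw [Matrix.mul_assoc, trace_coeffMatrix_mul, hL]
  simp only [systemMap, Pi.zero_apply, Matrix.of_apply]
  norm_cast

/-- The solution profiles at `u` are stable under `P ↦ P η_a P`, as far as the real ones are
concerned. -/
def IsStableAt (A : Fin p → (Fin q → ℝ) → Matrix (Fin m) (Fin q) ℝ)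
    (lam : Fin k → (Fin q → ℝ) → (Fin p → ℂ)) (ξ : Fin n → (Fin q → ℝ) → (Fin p → ℂ))
    (u : Fin q → ℝ) : Prop :=
  ∀ P ∈ solutionProfiles A lam u, IsRealProfile lam u P →
    ∀ a, P * etaMatrix lam ξ a u * P ∈ solutionProfiles A lam u

theorem IsRealProfile.add {P Q : Matrix (Fin q) (Fin k ⊕ Fin k) ℂ}
    (hP : IsRealProfile lam u P) (hQ : IsRealProfile lam u Q) : IsRealProfile lam u (P + Q) := by
  obtain ⟨L, hL⟩ := hP
  obtain ⟨K, hK⟩ := hQ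
  refine ⟨L + K, ?_⟩
  rw [Matrix.add_mul, hL, hK]
  ext α i
  simp

/-- Every solution profile is a complex combination of two real ones. -/
theorem exists_real_decomposition {Q : Matrix (Fin q) (Fin k ⊕ Fin k) ℂ}
    (hQ : Q ∈ solutionProfiles A lam u) :
    ∃ Q₁ ∈ solutionProfiles A lam u, ∃ Q₂ ∈ solutionProfiles A lam u,
      IsRealProfile lam u Q₁ ∧ IsRealProfile lam u Q₂ ∧ Q = Q₁ + Complex.I • Q₂ := by
  have hc := conjProfile_mem hQ
  refine ⟨(2⁻¹ : ℂ) • (Q + conjProfile Q), Submodule.smul_mem _ _ (Submodule.add_mem _ hQ hc),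
    (-Complex.I / 2) • (Q - conjProfile Q), Submodule.smul_mem _ _ (Submodule.sub_mem _ hQ hc),
    isRealProfile_of_conj_eq ?_, isRealProfile_of_conj_eq ?_, ?_⟩
  · ext α s
    simp [conjProfile]
    ring
  · ext α s
    simp [conjProfile]
    ring
  · ext α s
    simp only [Matrix.add_apply, Matrix.smul_apply, Matrix.sub_apply, smul_eq_mul]
    linear_combination ((Q α s - conjProfile Q α s) / 2) * Complex.I_mul_I

/-- Stability concerns real profiles only, whereas `P η_a P` need not be real because `ξ_a` is
complex. Polarization over the real profiles, followed by complex bilinearity, gives a closure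
property of all of W that can be iterated. -/
theorem IsStableAt.polarized (h : IsStableAt A lam ξ u) {P Q : Matrix (Fin q) (Fin k ⊕ Fin k) ℂ}
    (hP : P ∈ solutionProfiles A lam u) (hQ : Q ∈ solutionProfiles A lam u) (a : Fin n) :
    P * etaMatrix lam ξ a u * Q + Q * etaMatrix lam ξ a u * P ∈ solutionProfiles A lam u := by
  set W := solutionProfiles A lam u
  set η := etaMatrix lam ξ a u
  have hreal : ∀ P ∈ W, ∀ Q ∈ W, IsRealProfile lam u P → IsRealProfile lam u Q →
      P * η * Q + Q * η * P ∈ W := by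
    intro P hP Q hQ rP rQ
    have e : P * η * Q + Q * η * P = (P + Q) * η * (P + Q) - P * η * P - Q * η * Q := by
      simp only [Matrix.add_mul, Matrix.mul_add]
      abel
    rw [e]
    exact W.sub_mem (W.sub_mem (h _ (W.add_mem hP hQ) (rP.add rQ) a) (h _ hP rP a)) (h _ hQ rQ a)
  obtain ⟨P₁, hP₁, P₂, hP₂, rP₁, rP₂, rfl⟩ := exists_real_decomposition hP
  obtain ⟨Q₁, hQ₁, Q₂, hQ₂, rQ₁, rQ₂, rfl⟩ := exists_real_decomposition hQ
  have e : (P₁ + Complex.I • P₂) * η * (Q₁ + Complex.I • Q₂)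
      + (Q₁ + Complex.I • Q₂) * η * (P₁ + Complex.I • P₂)
      = (P₁ * η * Q₁ + Q₁ * η * P₁) + Complex.I • (P₁ * η * Q₂ + Q₂ * η * P₁)
        + Complex.I • (P₂ * η * Q₁ + Q₁ * η * P₂)
        + (Complex.I * Complex.I) • (P₂ * η * Q₂ + Q₂ * η * P₂) := by
    simp only [Matrix.add_mul, Matrix.mul_add, Matrix.smul_mul, Matrix.mul_smul, smul_add,
      smul_smul]
    abel
  rw [e]
  exact W.add_mem (W.add_mem (W.add_mem (hreal _ hP₁ _ hQ₁ rP₁ rQ₁)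
    (W.smul_mem _ (hreal _ hP₁ _ hQ₂ rP₁ rQ₂))) (W.smul_mem _ (hreal _ hP₂ _ hQ₁ rP₂ rQ₁)))
    (W.smul_mem _ (hreal _ hP₂ _ hQ₂ rP₂ rQ₂))

theorem trace_symWord (μ : Fin m) (P : Matrix (Fin q) (Fin k ⊕ Fin k) ℂ) {s : ℕ}
    (a : Fin s → Fin n) :
    (coeffMatrix A μ u * symWord P (fun b => etaMatrix lam ξ b u) a * waveMatrix lam u).trace
      = ∑ σ : Equiv.Perm (Fin s),
      (coeffMatrix A μ u * (List.ofFn fun j => P * etaMatrix lam ξ (a (σ j)) u).prod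
        * P * waveMatrix lam u).trace := by
  simp only [symWord, Matrix.mul_sum, Matrix.sum_mul, Matrix.trace_sum, Matrix.mul_assoc]

theorem IsStableAt.propagationCondition (h : IsStableAt A lam ξ u)
    {P : Matrix (Fin q) (Fin k ⊕ Fin k) ℂ} (hP : P ∈ solutionProfiles A lam u) (s : ℕ) :
    PropagationCondition A lam ξ u P s := fun μ a => by
  rw [← trace_symWord]
  exact symWord_mem (solutionProfiles A lam u) _ (fun P hP Q hQ a => h.polarized hP hQ a) hP s a μ

theorem mem_of_propagationCondition_one {P : Matrix (Fin q) (Fin k ⊕ Fin k) ℂ}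
    (h : PropagationCondition A lam ξ u P 1) (a : Fin n) :
    P * etaMatrix lam ξ a u * P ∈ solutionProfiles A lam u := fun μ => by
  have := h μ (fun _ => a)
  simpa [Matrix.mul_assoc] using this

/-- If `q ≤ 1` or `2k ≤ 1`, the map `P ↦ P η P` preserves the solution profiles automatically. -/
theorem mem_of_le_one {M : ℕ} (hM : M = q ∨ M = 2 * k) (hM1 : M ≤ 1)
    {P : Matrix (Fin q) (Fin k ⊕ Fin k) ℂ} (hP : P ∈ solutionProfiles A lam u)
    (η : Matrix (Fin k ⊕ Fin k) (Fin q) ℂ) : P * η * P ∈ solutionProfiles A lam u := by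
  rcases hM with rfl | rfl
  -- For `q ≤ 1` the `q × q` factor `P * η` is a scalar matrix.
  · have hs : Subsingleton (Fin M) := Fin.subsingleton_iff_le_one.2 hM1
    have : ∃ c : ℂ, P * η = c • (1 : Matrix (Fin M) (Fin M) ℂ) := by
      rcases isEmpty_or_nonempty (Fin M) with he | ⟨⟨i⟩⟩
      · exact ⟨0, by ext i; exact he.elim i⟩
      · refine ⟨(P * η) i i, ?_⟩
        ext a b
        rw [Subsingleton.elim a i, Subsingleton.elim b i]
        simp
    obtain ⟨c, hc⟩ := this
    rw [hc, Matrix.smul_mul, Matrix.one_mul]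
    exact Submodule.smul_mem _ _ hP
  -- By parity `2 * k ≤ 1` leaves only `k = 0`, and a profile then has no columns.
  · obtain rfl : k = 0 := by omega
    have : P * η * P = 0 := by
      ext i s
      rcases s with s | s <;> exact s.elim0
    rw [this]
    exact Submodule.zero_mem _

end Pointwise

/-! ### Profile functions with prescribed derivative -/

section Profile

variable {p q k : ℕ} {lam : Fin k → (Fin q → ℝ) → (Fin p → ℂ)} {u : Fin q → ℝ}

/-- The affine function with the value `u / 2` at `r₀` and the holomorphic derivative given by the
first half of `P`. -/
def affineProfile (u : Fin q → ℝ) (P : Matrix (Fin q) (Fin k ⊕ Fin k) ℂ) (r₀ : Fin k → ℂ) :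
    (Fin k → ℂ) → (Fin q → ℂ) :=
  fun r α => (u α : ℂ) / 2 + ∑ B, P α (Sum.inl B) * (r B - r₀ B)

/-- The derivative of `affineProfile`. -/
def affineProfileDeriv (P : Matrix (Fin q) (Fin k ⊕ Fin k) ℂ) : (Fin k → ℂ) →L[ℝ] (Fin q → ℂ) :=
  ContinuousLinearMap.pi fun α =>
    ∑ B, P α (Sum.inl B) • (ContinuousLinearMap.proj B : (Fin k → ℂ) →L[ℝ] ℂ)

theorem hasFDerivAt_affineProfile (u : Fin q → ℝ) (P : Matrix (Fin q) (Fin k ⊕ Fin k) ℂ)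
    (r₀ r : Fin k → ℂ) :
    HasFDerivAt (affineProfile u P r₀) (affineProfileDeriv P) r := by
  rw [hasFDerivAt_pi']
  intro α
  have h : HasFDerivAt (fun r : Fin k → ℂ => (u α : ℂ) / 2
      + ∑ B, P α (Sum.inl B) * (r B - r₀ B))
      (∑ B, P α (Sum.inl B) • (ContinuousLinearMap.proj B : (Fin k → ℂ) →L[ℝ] ℂ)) r := by
    refine HasFDerivAt.const_add _ (HasFDerivAt.fun_sum fun B _ => ?_)
    exact ((hasFDerivAt_apply B r).sub_const _).const_mul _
  exact h

theorem contDiff_affineProfile (u : Fin q → ℝ) (P : Matrix (Fin q) (Fin k ⊕ Fin k) ℂ)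
    (r₀ : Fin k → ℂ) : ContDiff ℝ ∞ (affineProfile u P r₀) := by
  unfold affineProfile
  fun_prop

theorem affineProfileDeriv_single (P : Matrix (Fin q) (Fin k ⊕ Fin k) ℂ) (B : Fin k) (c : ℂ)
    (α : Fin q) : affineProfileDeriv P (Pi.single B c) α = P α (Sum.inl B) * c := by
  simp [affineProfileDeriv, Pi.single_apply]

/-- The affine `f` is holomorphic with `∂f/∂r` the first half of `P`, while `∂f̄/∂r̄` is the
conjugate of that half. The latter is the second half of `P` exactly because `P` is fixed by
`conjProfile`. -/
theorem profileMatrix_affineProfile (P : Matrix (Fin q) (Fin k ⊕ Fin k) ℂ)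
    (hP : conjProfile P = P) (u : Fin q → ℝ) (r₀ r : Fin k → ℂ) :
    profileMatrix (affineProfile u P r₀) r = P := by
  have h1 := hasFDerivAt_affineProfile u P r₀ r
  have h2 : HasFDerivAt (fun t => star (affineProfile u P r₀ t))
      ((starL' ℝ : (Fin q → ℂ) ≃L[ℝ] (Fin q → ℂ)).toContinuousLinearMap.comp
        (affineProfileDeriv P)) r := h1.star
  ext α s
  have hs : star (P α s.swap) = P α s := congrFun (congrFun hP α) s
  rw [profileMatrix, Matrix.add_apply, derivR, derivR, Matrix.of_apply, Matrix.of_apply,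
    h1.fderiv, h2.fderiv]
  have e : ∀ v, ((starL' ℝ : (Fin q → ℂ) ≃L[ℝ] (Fin q → ℂ)).toContinuousLinearMap.comp
        (affineProfileDeriv P)) v α = star (affineProfileDeriv P v α) := fun v => rfl
  rcases s with B | B
  · simp only [Sum.elim_inl, e, affineProfileDeriv_single]
    simp
    linear_combination (-(P α (Sum.inl B)) / 2 + starRingEnd ℂ (P α (Sum.inl B)) / 2) * Complex.I_mul_I
  · simp only [Sum.elim_inr, e, affineProfileDeriv_single]
    simp only [Sum.swap_inr] at hs
    simp [← hs]
    linear_combination (P α (Sum.inl B) / 2 - starRingEnd ℂ (P α (Sum.inl B)) / 2) * Complex.I_mul_I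

theorem affineProfile_self (u : Fin q → ℝ) (P : Matrix (Fin q) (Fin k ⊕ Fin k) ℂ)
    (r₀ : Fin k → ℂ) (α : Fin q) :
    (u α : ℂ) = affineProfile u P r₀ r₀ α + star (affineProfile u P r₀ r₀ α) := by
  simp [affineProfile]

end Profile

/-! ### Prolongation in terms of profile matrices -/

section Prolongation

variable {p q m k n : ℕ} {A : Fin p → (Fin q → ℝ) → Matrix (Fin m) (Fin q) ℝ}
  {lam : Fin k → (Fin q → ℝ) → (Fin p → ℂ)} {ξ : Fin n → (Fin q → ℝ) → (Fin p → ℂ)}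
  {U : Set (Fin q → ℝ)} {u : Fin q → ℝ}

theorem IsWaveSystem.contDiffOn_apply (hlam : IsWaveSystem A lam U) (B : Fin k) (i : Fin p) :
    ContDiffOn ℝ ∞ (fun v => lam B v i) U :=
  (contDiffOn_pi.1 (hlam.smooth B)) i

theorem IsWaveSystem.contDiffOn_waveMatrix (hlam : IsWaveSystem A lam U) (s : Fin k ⊕ Fin k)
    (i : Fin p) : ContDiffOn ℝ ∞ (fun v => waveMatrix lam v s i) U := by
  rcases s with B | B
  · exact hlam.contDiffOn_apply B i
  · exact Complex.conjCLE.contDiff.comp_contDiffOn (hlam.contDiffOn_apply B i)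

theorem IsOrthogonalFrame.contDiffOn_apply (hξ : IsOrthogonalFrame lam ξ U) (a : Fin n)
    (i : Fin p) : ContDiffOn ℝ ∞ (fun v => ξ a v i) U :=
  (contDiffOn_pi.1 (hξ.smooth a)) i

theorem differentiableAt_of_contDiffOn {E F : Type*} [NormedAddCommGroup E] [NormedSpace ℝ E]
    [NormedAddCommGroup F] [NormedSpace ℝ F] {f : E → F} {s : Set E} (hs : IsOpen s)
    (hf : ContDiffOn ℝ ∞ f s) {x : E} (hx : x ∈ s) : DifferentiableAt ℝ f x :=
  (hf.contDiffAt (hs.mem_nhds hx)).differentiableAt (by simp)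

/-- Differentiating the identity `Λ ξ_a = 0` in `u` trades the derivatives of `ξ_a`, which occur in
the prolongation, for those of `Λ`, which occur in `η_a`. -/
theorem sum_xi_mul_partialU_waveMatrix (hU : IsOpen U) (hlam : IsWaveSystem A lam U)
    (hξ : IsOrthogonalFrame lam ξ U) (hu : u ∈ U) (s : Fin k ⊕ Fin k) (a : Fin n) (β : Fin q) :
    ∑ i, ξ a u i * partialU (fun v => waveMatrix lam v s i) β u
      = -∑ i, partialU (fun v => ξ a v i) β u * waveMatrix lam u s i := by
  have h1 : HasFDerivAt (fun v => ∑ i, waveMatrix lam v s i * ξ a v i)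
      (∑ i, (waveMatrix lam u s i • fderiv ℝ (fun v => ξ a v i) u
        + ξ a u i • fderiv ℝ (fun v => waveMatrix lam v s i) u)) u :=
    HasFDerivAt.fun_sum fun i _ =>
      (differentiableAt_of_contDiffOn hU (hlam.contDiffOn_waveMatrix s i) hu).hasFDerivAt.mul
        (differentiableAt_of_contDiffOn hU (hξ.contDiffOn_apply a i) hu).hasFDerivAt
  have h2 : HasFDerivAt (fun v => ∑ i, waveMatrix lam v s i * ξ a v i)
      (0 : (Fin q → ℝ) →L[ℝ] ℂ) u := by
    refine (hasFDerivAt_const (0 : ℂ) u).congr_of_eventuallyEq ?_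
    filter_upwards [hU.mem_nhds hu] with v hv using hξ.waveMatrix_orthogonal hv s a
  have h3 := congrArg (fun T : (Fin q → ℝ) →L[ℝ] ℂ => T (Pi.single β 1)) (h1.unique h2)
  simp only [_root_.sum_apply, _root_.add_apply,
    _root_.smul_apply, smul_eq_mul, _root_.zero_apply,
    Finset.sum_add_distrib] at h3
  rw [eq_neg_iff_add_eq_zero, ← h3, add_comm]
  congr 1
  exact Finset.sum_congr rfl fun i _ => mul_comm _ _

theorem differentiableAt_systemMap (hU : IsOpen U)
    (hA : ∀ i μ α, ContDiffOn ℝ ∞ (fun u => A i u μ α) U) (z : Jet p q) (hz : z.2.1 ∈ U)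
    (μ : Fin m) : DifferentiableAt ℝ (fun w : Jet p q => systemMap A w μ) z := by
  unfold systemMap
  refine DifferentiableAt.fun_sum fun i _ => DifferentiableAt.fun_sum fun α _ => ?_
  refine DifferentiableAt.mul ?_ (by fun_prop)
  exact (differentiableAt_of_contDiffOn hU (hA i μ α) hz).comp z
    (f := fun w : Jet p q => w.2.1) (by fun_prop)

/-- The direction leaves `u` fixed, so the system is affine along the line and no derivative of `A`
appears. -/
theorem fderiv_systemMap (hU : IsOpen U)
    (hA : ∀ i μ α, ContDiffOn ℝ ∞ (fun u => A i u μ α) U) (z : Jet p q) (hz : z.2.1 ∈ U)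
    (μ : Fin m) (v : Fin p → ℝ) (K : Fin q → Fin p → ℝ) :
    fderiv ℝ (fun w : Jet p q => systemMap A w μ) z (v, 0, K)
      = ∑ i, ∑ α, A i z.2.1 μ α * K α i := by
  rw [← (differentiableAt_systemMap hU hA z hz μ).lineDeriv_eq_fderiv, lineDeriv]
  have h : (fun t : ℝ => systemMap A (z + t • ((v, 0, K) : Jet p q)) μ)
      = fun t => systemMap A z μ + t * ∑ i, ∑ α, A i z.2.1 μ α * K α i := by
    funext t
    simp only [systemMap, Prod.snd_add, Prod.fst_add, Prod.smul_snd, Prod.smul_fst, smul_zero,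
      add_zero, Pi.add_apply, Pi.smul_apply, smul_eq_mul, Finset.mul_sum, mul_add,
      Finset.sum_add_distrib]
    congr 1
    exact Finset.sum_congr rfl fun i _ => Finset.sum_congr rfl fun α _ => by ring
  rw [h, deriv_const_add, deriv_mul_const differentiableAt_id]
  simp

/-- On the jet given by `P`, the prolonged field sends the system to the trace condition of
order one. -/
theorem prolongation_systemMap (hU : IsOpen U)
    (hA : ∀ i μ α, ContDiffOn ℝ ∞ (fun u => A i u μ α) U) (hlam : IsWaveSystem A lam U)
    (hξ : IsOrthogonalFrame lam ξ U) (hu : u ∈ U) (x : Fin p → ℝ)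
    {P : Matrix (Fin q) (Fin k ⊕ Fin k) ℂ} {L : Fin q → Fin p → ℝ}
    (hL : P * waveMatrix lam u = Matrix.of fun α i => (L α i : ℂ)) (a : Fin n) (μ : Fin m) :
    prolongation ξ a (fun w => systemMap A w μ) (x, u, L)
      = (coeffMatrix A μ u * (P * etaMatrix lam ξ a u * P) * waveMatrix lam u).trace := by
  have hLs : ∀ α i, ∑ s, P α s * waveMatrix lam u s i = (L α i : ℂ) := fun α i => by
    have := congrFun (congrFun hL α) i
    rwa [Matrix.mul_apply] at this
  have hPη : ∀ α β, (P * etaMatrix lam ξ a u) α β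
      = -∑ i, partialU (fun v => ξ a v i) β u * (L α i : ℂ) := fun α β => by
    simp_rw [Matrix.mul_apply, etaMatrix, Matrix.of_apply,
      sum_xi_mul_partialU_waveMatrix hU hlam hξ hu, ← hLs, mul_neg, Finset.sum_neg_distrib,
      Finset.mul_sum]
    rw [Finset.sum_comm]
    congr 1
    exact Finset.sum_congr rfl fun i _ => Finset.sum_congr rfl fun s _ => by ring
  have hx : ∀ v : Fin p → ℝ,
      fderiv ℝ (fun w : Jet p q => systemMap A w μ) (x, u, L) (v, 0, 0) = 0 := fun v => by
    rw [fderiv_systemMap hU hA _ hu]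
    simp
  have hK : ∀ α j, fderiv ℝ (fun w : Jet p q => systemMap A w μ) (x, u, L)
      (0, 0, Pi.single α (Pi.single j 1)) = A j u μ α := fun α j => by
    rw [fderiv_systemMap hU hA _ hu, Finset.sum_eq_single j, Finset.sum_eq_single α]
    · simp
    · intro b _ hb
      simp [Pi.single_eq_of_ne hb]
    · simp
    · intro b _ hb
      refine Finset.sum_eq_zero fun c _ => ?_
      rcases eq_or_ne c α with rfl | hc
      · simp [Pi.single_eq_of_ne hb]
      · simp [Pi.single_eq_of_ne hc]
    · simp
  rw [prolongation]
  simp_rw [hx, hK]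
  rw [Matrix.mul_assoc, Matrix.mul_assoc _ P, hL, trace_coeffMatrix_mul]
  simp_rw [Matrix.mul_apply (M := P * etaMatrix lam ξ a u), hPη, Matrix.of_apply]
  simp only [Complex.ofReal_zero, mul_zero, Finset.sum_const_zero, zero_sub]
  rw [Finset.sum_comm, ← Finset.sum_neg_distrib]
  refine Finset.sum_congr rfl fun j _ => ?_
  rw [← Finset.sum_neg_distrib]
  refine Finset.sum_congr rfl fun α _ => ?_
  rw [Finset.sum_comm, Finset.sum_mul, Finset.mul_sum, ← Finset.sum_neg_distrib]
  refine Finset.sum_congr rfl fun β _ => ?_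
  rw [neg_mul, mul_neg, Finset.sum_mul, Finset.sum_mul, Finset.mul_sum]
  congr 1
  exact Finset.sum_congr rfl fun i _ => by ring

theorem fderiv_comp_snd_apply {E F G : Type*} [NormedAddCommGroup E] [NormedSpace ℝ E]
    [NormedAddCommGroup F] [NormedSpace ℝ F] [NormedAddCommGroup G] [NormedSpace ℝ G]
    {g : F → G} {y : E × F} (hg : DifferentiableAt ℝ g y.2) (v : E) :
    fderiv ℝ (fun t : E × F => g t.2) y (v, 0) = 0 := by
  have : HasFDerivAt (fun t : E × F => g t.2)
      ((fderiv ℝ g y.2).comp (ContinuousLinearMap.snd ℝ E F)) y :=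
    hg.hasFDerivAt.comp y hasFDerivAt_snd
  rw [this.fderiv]
  simp

/-- The coefficients depend on `u` alone and the fields differentiate in `x` alone. -/
theorem bracket_fieldX (hU : IsOpen U) (hξ : IsOrthogonalFrame lam ξ U)
    {y : (Fin p → ℝ) × (Fin q → ℝ)} (hy : y.2 ∈ U) (a b : Fin n) :
    bracket (fieldX ξ a) (fieldX ξ b) y = 0 := by
  have h : ∀ c i v, fderiv ℝ (fun t : (Fin p → ℝ) × (Fin q → ℝ) => ξ c t.2 i) y (v, 0) = 0 :=
    fun c i v => fderiv_comp_snd_apply (g := fun t => ξ c t i)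
      (differentiableAt_of_contDiffOn hU (hξ.contDiffOn_apply c i) hy) v
  ext i <;> simp [bracket, applyField, fieldX, h]

theorem linearIndependent_fieldX (hξ : IsOrthogonalFrame lam ξ U)
    {N : Set ((Fin p → ℝ) × (Fin q → ℝ))} {y : (Fin p → ℝ) × (Fin q → ℝ)} (hy : y ∈ N)
    (hyU : y.2 ∈ U) : LinearIndependent ℂ (fun (a : Fin n) (y : N) => fieldX ξ a y) := by
  rw [Fintype.linearIndependent_iff]
  intro g hg
  refine Fintype.linearIndependent_iff.1 (hξ.independent y.2 hyU) g ?_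
  have := congrArg Prod.fst (congrFun hg ⟨y, hy⟩)
  simpa [fieldX, Finset.sum_apply, Prod.fst_sum] using this

end Prolongation

/-! ### Equivalence of the symmetry conditions and the trace conditions -/

section Equivalence

variable {p q m k : ℕ} {A : Fin p → (Fin q → ℝ) → Matrix (Fin m) (Fin q) ℝ}
  {lam : Fin k → (Fin q → ℝ) → (Fin p → ℂ)} {ξ : Fin (p - 2 * k) → (Fin q → ℝ) → (Fin p → ℂ)}
  {U : Set (Fin q → ℝ)} {u : Fin q → ℝ}

theorem isStableAt_iff_prolongation (hU : IsOpen U)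
    (hA : ∀ i μ α, ContDiffOn ℝ ∞ (fun u => A i u μ α) U) (hlam : IsWaveSystem A lam U)
    (hξ : IsOrthogonalFrame lam ξ U) (hu : u ∈ U) (x : Fin p → ℝ) :
    IsStableAt A lam ξ u ↔ ∀ L : Fin q → Fin p → ℝ, (x, u, L) ∈ SDelta A U ∩ SQ ξ →
      ∀ a μ, prolongation ξ a (fun w => systemMap A w μ) (x, u, L) = 0 := by
  constructor
  · rintro h L ⟨hΔ, hQ⟩ a μ
    obtain ⟨P, hP⟩ := exists_profile (hlam.independent u hu) hξ hu hQ
    rw [prolongation_systemMap hU hA hlam hξ hu x hP]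
    exact h P ((mem_solutionProfiles_iff_systemMap x hP).2 hΔ.2) ⟨L, hP⟩ a μ
  · rintro h P hP ⟨L, hL⟩ a μ
    rw [← prolongation_systemMap hU hA hlam hξ hu x hL]
    exact h L ⟨⟨hu, (mem_solutionProfiles_iff_systemMap x hL).1 hP⟩,
      sum_mul_eq_zero_of_profile hξ hu hL⟩ a μ

theorem isStableAt_iff_trace {M : ℕ} (hM : M = q ∨ M = 2 * k) (hlam : IsWaveSystem A lam U)
    (hξ : IsOrthogonalFrame lam ξ U) (hu : u ∈ U) (x : Fin p → ℝ) :
    IsStableAt A lam ξ u ↔ ∀ L : Fin q → Fin p → ℝ, (x, u, L) ∈ SDelta A U ∩ SQ ξ →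
      ∀ f : (Fin k → ℂ) → (Fin q → ℂ),
        ContDiffAt ℝ ∞ f (riemannInvariant lam x u) →
        (∀ α, (u α : ℂ) = f (riemannInvariant lam x u) α
          + star (f (riemannInvariant lam x u) α)) →
        profileMatrix f (riemannInvariant lam x u) * waveMatrix lam u
          = Matrix.of (fun α i => (L α i : ℂ)) →
        InitialCondition A lam u (profileMatrix f (riemannInvariant lam x u)) ∧
        ∀ s, 1 ≤ s → s < M → PropagationCondition A lam ξ u
          (profileMatrix f (riemannInvariant lam x u)) s := by
  constructor
  · rintro h L ⟨hΔ, -⟩ f - - hP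
    have hW := (mem_solutionProfiles_iff_systemMap x hP).2 hΔ.2
    exact ⟨hW, fun s _ _ => h.propagationCondition hW s⟩
  · intro h P hW hreal a
    -- For `M ≤ 1` no propagation condition is imposed, so stability has to hold by itself; for `M ≥
    -- 2` the order `s = 1` is among the conditions.
    rcases le_or_gt M 1 with hM1 | hM1
    · exact mem_of_le_one hM hM1 hW _
    have hconj := hreal.conj_eq (hlam.independent u hu)
    obtain ⟨L, hL⟩ := hreal
    set r := riemannInvariant lam x u
    have hprof := profileMatrix_affineProfile P hconj u r r
    have := (h L ⟨⟨hu, (mem_solutionProfiles_iff_systemMap x hL).1 hW⟩,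
      sum_mul_eq_zero_of_profile hξ hu hL⟩ (affineProfile u P r)
      (contDiff_affineProfile u P r).contDiffAt (affineProfile_self u P r)
      (by rw [hprof, hL])).2 1 le_rfl hM1
    rw [hprof] at this
    exact mem_of_propagationCondition_one this a

/-- Only the prolongation condition has content; the same `N` serves on both sides. -/
theorem generatesSymmetryAlgebraNear_iff (hU : IsOpen U)
    (hA : ∀ i μ α, ContDiffOn ℝ ∞ (fun u => A i u μ α) U) (hlam : IsWaveSystem A lam U)
    (hξ : IsOrthogonalFrame lam ξ U) (y₀ : (Fin p → ℝ) × (Fin q → ℝ)) :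
    GeneratesSymmetryAlgebraNear A U ξ y₀ ↔
      ∃ N ∈ 𝓝 y₀, N ⊆ univ ×ˢ U ∧ ∀ y ∈ N, IsStableAt A lam ξ y.2 := by
  refine exists_congr fun N => and_congr_right fun hN => and_congr_right fun hNU => ?_
  constructor
  · intro h y hy
    rw [isStableAt_iff_prolongation hU hA hlam hξ (hNU hy).2 y.1]
    exact fun L hL => h.symmetric (y.1, y.2, L) hL hy
  · intro h
    refine ⟨linearIndependent_fieldX hξ (mem_of_mem_nhds hN) (hNU (mem_of_mem_nhds hN)).2,
      fun a b y hy => bracket_fieldX hU hξ (hNU hy).2 a b, ?_⟩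
    rintro ⟨x, u, L⟩ hz hy
    exact (isStableAt_iff_prolongation hU hA hlam hξ (hNU hy).2 x).1 (h _ hy) L hz

theorem traceConditionsNear_iff {M : ℕ} (hM : M = q ∨ M = 2 * k)
    (hlam : IsWaveSystem A lam U)
    (hξ : IsOrthogonalFrame lam ξ U) (y₀ : (Fin p → ℝ) × (Fin q → ℝ)) :
    TraceConditionsNear M A lam U ξ y₀ ↔
      ∃ N ∈ 𝓝 y₀, N ⊆ univ ×ˢ U ∧ ∀ y ∈ N, IsStableAt A lam ξ y.2 := by
  refine exists_congr fun N => and_congr_right fun hN => and_congr_right fun hNU => ?_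
  constructor
  · intro h y hy
    rw [isStableAt_iff_trace hM hlam hξ (hNU hy).2 y.1]
    exact fun L hL => h (y.1, y.2, L) hL hy
  · rintro h ⟨x, u, L⟩ hz hy
    exact (isStableAt_iff_trace hM hlam hξ (hNU hy).2 x).1 (h _ hy) L hz

/-- Stability does not depend on the frame of the orthogonal complement. -/
theorem IsStableAt.of_frame {ξ' : Fin (p - 2 * k) → (Fin q → ℝ) → (Fin p → ℂ)}
    {U' : Set (Fin q → ℝ)} (h : IsStableAt A lam ξ' u)
    (hΛ : LinearIndependent ℂ (fun s => waveMatrix lam u s)) (hξ : IsOrthogonalFrame lam ξ U)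
    (hξ' : IsOrthogonalFrame lam ξ' U') (hu : u ∈ U) (hu' : u ∈ U') : IsStableAt A lam ξ u := by
  intro P hP hreal a
  obtain ⟨t, ht⟩ := mem_span_of_orthogonal (hξ'.independent u hu') hΛ (card_sum_add_sub hΛ)
    (fun i j => hξ'.waveMatrix_orthogonal hu' j i) (fun j => hξ.waveMatrix_orthogonal hu j a)
  -- `η_a` involves only the value of `ξ_a` at `u`, not its derivatives, so a pointwise change of
  -- frame acts linearly on it.
  have hη : etaMatrix lam ξ a u = ∑ b, t b • etaMatrix lam ξ' b u := by
    ext s β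
    simp only [etaMatrix, Matrix.of_apply, Matrix.sum_apply, Matrix.smul_apply, smul_eq_mul,
      Finset.mul_sum]
    rw [Finset.sum_comm]
    refine Finset.sum_congr rfl fun i _ => ?_
    rw [← ht]
    simp [Finset.sum_mul, mul_assoc]
  rw [hη, Matrix.mul_sum, Matrix.sum_mul]
  refine Submodule.sum_mem _ fun b _ => ?_
  rw [Matrix.mul_smul, Matrix.smul_mul]
  exact Submodule.smul_mem _ _ (h P hP hreal b)

theorem IsWaveSystem.mono {U' : Set (Fin q → ℝ)} (hlam : IsWaveSystem A lam U) (h : U' ⊆ U) :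
    IsWaveSystem A lam U' :=
  ⟨fun B => (hlam.smooth B).mono h, fun u hu => hlam.dispersion u (h hu),
    fun u hu => hlam.independent u (h hu)⟩

theorem admitsSymmetryAlgebraNear_iff (hU : IsOpen U)
    (hA : ∀ i μ α, ContDiffOn ℝ ∞ (fun u => A i u μ α) U) (hlam : IsWaveSystem A lam U)
    (hξ : IsOrthogonalFrame lam ξ U) {y₀ : (Fin p → ℝ) × (Fin q → ℝ)} (hy₀ : y₀.2 ∈ U) :
    AdmitsSymmetryAlgebraNear A lam U y₀ ↔
      ∃ N ∈ 𝓝 y₀, N ⊆ univ ×ˢ U ∧ ∀ y ∈ N, IsStableAt A lam ξ y.2 := by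
  constructor
  · rintro ⟨U', ξ', hU', -, hUU', hξ', h⟩
    rw [generatesSymmetryAlgebraNear_iff hU' (fun i μ α => (hA i μ α).mono hUU')
      (hlam.mono hUU') hξ'] at h
    obtain ⟨N, hN, hNU, h⟩ := h
    have hNU' : N ⊆ univ ×ˢ U := hNU.trans (prod_mono_right hUU')
    exact ⟨N, hN, hNU', fun y hy => (h y hy).of_frame (hlam.independent _ (hNU' hy).2) hξ hξ'
      (hNU' hy).2 (hNU hy).2⟩
  · intro h
    exact ⟨U, ξ, hU, hy₀, Subset.rfl, hξ,
      (generatesSymmetryAlgebraNear_iff hU hA hlam hξ y₀).2 h⟩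

end Equivalence

/-! ### Functional dependence -/

/-- If `r` is a submersion at `x₀` and the derivative of `u` vanishes on the kernel of that of `r`,
then near `x₀` the map `u` is a smooth function of `r`. -/
theorem exists_factor_through_submersion {E F G : Type*}
    [NormedAddCommGroup E] [NormedSpace ℝ E] [FiniteDimensional ℝ E]
    [NormedAddCommGroup F] [NormedSpace ℝ F] [FiniteDimensional ℝ F]
    [NormedAddCommGroup G] [NormedSpace ℝ G]
    {r : E → F} {u : E → G} {D : Set E} (hD : IsOpen D) (hr : ContDiffOn ℝ ∞ r D)
    (hu : ContDiffOn ℝ ∞ u D) {x₀ : E} (hx₀ : x₀ ∈ D)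
    (hsurj : Function.Surjective (fderiv ℝ r x₀))
    (hker : ∀ᶠ x in 𝓝 x₀, Function.Surjective (fderiv ℝ r x) →
      ∀ v, fderiv ℝ r x v = 0 → fderiv ℝ u x v = 0) :
    ∃ (O : Set F) (g : F → G), IsOpen O ∧ ContDiffOn ℝ ∞ g O ∧
      ∀ᶠ x in 𝓝 x₀, r x ∈ O ∧ u x = g (r x) := by
  have : CompleteSpace E := FiniteDimensional.complete ℝ E
  set K : Submodule ℝ E := LinearMap.ker (fderiv ℝ r x₀ : E →ₗ[ℝ] F) with hK
  obtain ⟨π₀, hπ₀⟩ := LinearMap.exists_leftInverse_of_injective K.subtype K.ker_subtype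
  set π : E →L[ℝ] K := LinearMap.toContinuousLinearMap π₀
  have hπ : ∀ κ : K, π κ = κ := fun κ => congrArg (fun T : K →ₗ[ℝ] K => T κ) hπ₀
  -- A projection onto `ker dr(x₀)` completes `r` to a local diffeomorphism. In these coordinates
  -- `u` has zero derivative in the `K` direction.
  set Φ : E → F × K := fun x => (r x, π x)
  have hΦs : ContDiffOn ℝ ∞ Φ D := hr.prodMk π.contDiff.contDiffOn
  have hΦd : ∀ x ∈ D, HasFDerivAt Φ ((fderiv ℝ r x).prod π) x := fun x hx =>
    (differentiableAt_of_contDiffOn hD hr hx).hasFDerivAt.prodMk π.hasFDerivAt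
  have hbij : Function.Bijective ((fderiv ℝ r x₀).prod π) := by
    constructor
    · rw [injective_iff_map_eq_zero]
      intro v hv
      have h1 : fderiv ℝ r x₀ v = 0 := congrArg Prod.fst hv
      have h2 : π v = 0 := congrArg Prod.snd hv
      have h3 := hπ ⟨v, h1⟩
      rw [h2] at h3
      exact congrArg Subtype.val h3.symm
    · rintro ⟨c, κ⟩
      obtain ⟨v, hv⟩ := hsurj c
      have hmem : ∀ κ : K, fderiv ℝ r x₀ κ = 0 := fun κ => κ.2
      refine ⟨v - (π v : E) + (κ : E), ?_⟩
      ext1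
      · simp [hv, hmem]
      · simp [hπ]
  let T₀ : E ≃L[ℝ] F × K := (LinearEquiv.ofBijective
    ((fderiv ℝ r x₀).prod π : E →ₗ[ℝ] F × K) hbij).toContinuousLinearEquiv
  have hT₀ : (T₀ : E →L[ℝ] F × K) = (fderiv ℝ r x₀).prod π := by
    ext v <;> rfl
  have hΦx₀ : ContDiffAt ℝ ∞ Φ x₀ := hΦs.contDiffAt (hD.mem_nhds hx₀)
  have hΦ' : HasFDerivAt Φ (T₀ : E →L[ℝ] F × K) x₀ := hT₀ ▸ hΦd x₀ hx₀
  let e := hΦx₀.toOpenPartialHomeomorph Φ hΦ' (by simp)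
  have hsrc : x₀ ∈ e.source := hΦx₀.mem_toOpenPartialHomeomorph_source hΦ' (by simp)
  -- Invertible operators form an open set. Nearby invertibility of `dΦ` gives both smoothness of
  -- the inverse and the surjectivity of `dr` that `hker` asks for.
  have hequiv : ∀ᶠ x in 𝓝 x₀, fderiv ℝ Φ x ∈ range ((↑) : (E ≃L[ℝ] F × K) → E →L[ℝ] F × K) := by
    have hc : ContinuousAt (fderiv ℝ Φ) x₀ :=
      (hΦx₀.fderiv_right (m := 0) (by simp)).continuousAt
    refine hc.eventually ?_
    rw [hΦ'.fderiv]
    exact ContinuousLinearEquiv.nhds T₀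
  have hgood : ∀ᶠ y in 𝓝 (Φ x₀), y ∈ e.target ∧ e.symm y ∈ D ∧
      fderiv ℝ Φ (e.symm y) ∈ range ((↑) : (E ≃L[ℝ] F × K) → E →L[ℝ] F × K) ∧
      (Function.Surjective (fderiv ℝ r (e.symm y)) →
        ∀ v, fderiv ℝ r (e.symm y) v = 0 → fderiv ℝ u (e.symm y) v = 0) := by
    have ht : Φ x₀ ∈ e.target := e.map_source hsrc
    have hsymm : e.symm (Φ x₀) = x₀ := e.left_inv hsrc
    have hc : Filter.Tendsto e.symm (𝓝 (Φ x₀)) (𝓝 x₀) := by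
      have := e.continuousAt_symm ht
      rwa [ContinuousAt, hsymm] at this
    filter_upwards [e.open_target.mem_nhds ht, hc.eventually (hD.mem_nhds hx₀),
      hc.eventually hequiv, hc.eventually hker] with y h1 h2 h3 h4
    exact ⟨h1, h2, h3, h4⟩
  obtain ⟨ε, hε, hball⟩ := Metric.eventually_nhds_iff_ball.1 hgood
  have hsymmd : ∀ y ∈ Metric.ball (Φ x₀) ε, ContDiffAt ℝ ∞ e.symm y ∧
      ∀ κ : K, fderiv ℝ (fun y => u (e.symm y)) y (0, κ) = 0 := by
    intro y hy
    obtain ⟨ht, hyD, ⟨T, hT⟩, hk⟩ := hball y hy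
    have hTd : HasFDerivAt Φ (T : E →L[ℝ] F × K) (e.symm y) := by
      rw [hT]
      exact (hΦd _ hyD).differentiableAt.hasFDerivAt
    have hTeq : (T : E →L[ℝ] F × K) = (fderiv ℝ r (e.symm y)).prod π :=
      hTd.unique (hΦd _ hyD)
    have hsm : ContDiffAt ℝ ∞ e.symm y :=
      e.contDiffAt_symm ht hTd (hΦs.contDiffAt (hD.mem_nhds hyD))
    refine ⟨hsm, fun κ => ?_⟩
    have hsd : HasFDerivAt e.symm (T.symm : F × K →L[ℝ] E) y := e.hasFDerivAt_symm ht hTd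
    have hud : HasFDerivAt u (fderiv ℝ u (e.symm y)) (e.symm y) :=
      (differentiableAt_of_contDiffOn hD hu hyD).hasFDerivAt
    have hcomp : HasFDerivAt (fun y => u (e.symm y))
        ((fderiv ℝ u (e.symm y)).comp (T.symm : F × K →L[ℝ] E)) y := hud.comp y hsd
    rw [hcomp.fderiv]
    have hTap : ∀ v, T v = (fderiv ℝ r (e.symm y) v, π v) := fun v =>
      congrArg (fun S : E →L[ℝ] F × K => S v) hTeq
    refine hk (fun c => ?_) _ ?_
    · obtain ⟨v, hv⟩ := T.surjective (c, 0)
      exact ⟨v, by rw [hTap] at hv; exact congrArg Prod.fst hv⟩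
    · have := hTap (T.symm (0, κ))
      rw [ContinuousLinearEquiv.apply_symm_apply] at this
      exact (congrArg Prod.fst this).symm
  -- In the sup norm a ball is a product of balls, so each slice with fixed `r` is convex and `u` is
  -- constant along it.
  have hΦ₀ : Metric.ball (Φ x₀) ε = Metric.ball (r x₀) ε ×ˢ Metric.ball (π x₀) ε :=
    (ball_prod_same _ _ _).symm
  have hcd : ∀ y ∈ Metric.ball (Φ x₀) ε, ContDiffAt ℝ ∞ (fun y => u (e.symm y)) y := fun y hy =>
    (hu.contDiffAt (hD.mem_nhds (hball y hy).2.1)).comp y (hsymmd y hy).1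
  refine ⟨Metric.ball (r x₀) ε, fun c => u (e.symm (c, π x₀)), Metric.isOpen_ball, ?_, ?_⟩
  · intro c hc
    refine ContDiffAt.contDiffWithinAt ?_
    exact (hcd (c, π x₀) (by rw [hΦ₀]; exact ⟨hc, Metric.mem_ball_self hε⟩)).comp c
      (f := fun c => (c, π x₀)) (contDiffAt_id.prodMk contDiffAt_const)
  · filter_upwards [e.open_source.mem_nhds hsrc,
      hΦx₀.continuousAt.eventually (Metric.ball_mem_nhds _ hε)] with x hxs hx
    have hx' : r x ∈ Metric.ball (r x₀) ε ∧ π x ∈ Metric.ball (π x₀) ε := by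
      rw [← Metric.mem_ball, hΦ₀] at hx
      exact hx
    refine ⟨hx'.1, ?_⟩
    have hfd : ∀ κ ∈ Metric.ball (π x₀) ε,
        HasFDerivAt (fun κ => u (e.symm (r x, κ))) (0 : K →L[ℝ] G) κ := by
      intro κ hκ
      have hy : (r x, κ) ∈ Metric.ball (Φ x₀) ε := by rw [hΦ₀]; exact ⟨hx'.1, hκ⟩
      have h1 := ((hcd _ hy).differentiableAt (by simp)).hasFDerivAt
      have h2 : HasFDerivAt (fun κ => u (e.symm (r x, κ))) _ κ :=
        h1.comp κ (hasFDerivAt_prodMk_right (r x) κ)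
      exact h2.congr_fderiv (ContinuousLinearMap.ext fun v => (hsymmd _ hy).2 v)
    have hconst := Metric.isOpen_ball.is_const_of_fderiv_eq_zero (𝕜 := ℝ)
      (convex_ball (π x₀) ε).isPreconnected
      (fun κ hκ => (hfd κ hκ).differentiableAt.differentiableWithinAt)
      (fun κ hκ => (hfd κ hκ).fderiv) hx'.2 (Metric.mem_ball_self hε)
    rw [← hconst]
    exact congrArg u (e.left_inv hxs).symm

/-! ### Invariant maps and the Riemann invariants -/

section Modes

variable {p q m k : ℕ} {A : Fin p → (Fin q → ℝ) → Matrix (Fin m) (Fin q) ℝ}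
  {lam : Fin k → (Fin q → ℝ) → (Fin p → ℂ)} {ξ : Fin (p - 2 * k) → (Fin q → ℝ) → (Fin p → ℂ)}
  {U : Set (Fin q → ℝ)} {v : Fin q → ℝ}

/-- The real-linear map `x ↦ (λ^B_i(v) x^i)_B`. -/
def waveCLM (lam : Fin k → (Fin q → ℝ) → (Fin p → ℂ)) (v : Fin q → ℝ) :
    (Fin p → ℝ) →L[ℝ] (Fin k → ℂ) :=
  ContinuousLinearMap.pi fun B => ∑ i, lam B v i •
    (Complex.ofRealCLM.comp (ContinuousLinearMap.proj i : (Fin p → ℝ) →L[ℝ] ℝ))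

theorem waveCLM_apply (x : Fin p → ℝ) (B : Fin k) :
    waveCLM lam v x B = ∑ i, lam B v i * (x i : ℂ) := by
  simp [waveCLM]

theorem waveCLM_eq_zero_iff (x : Fin p → ℝ) :
    waveCLM lam v x = 0 ↔ ∀ s, ∑ i, waveMatrix lam v s i * (x i : ℂ) = 0 := by
  constructor
  · rintro h (B | B)
    · exact (waveCLM_apply x B).symm.trans (congrFun h B)
    · have := congrArg star ((waveCLM_apply x B).symm.trans (congrFun h B))
      simpa [waveMatrix] using this
  · intro h
    funext B
    rw [waveCLM_apply]
    exact h (Sum.inl B)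

theorem waveCLM_surjective (hΛ : LinearIndependent ℂ (fun s => waveMatrix lam v s)) :
    Function.Surjective (waveCLM lam v) := by
  intro c
  have hli : LinearIndependent ℂ (waveMatrix lam v).row := hΛ
  have htop : LinearMap.range (waveMatrix lam v).mulVecLin = ⊤ := by
    apply Submodule.eq_top_of_finrank_eq
    rw [← Matrix.rank, hli.rank_matrix]
    simp
  -- A complex `y` is chosen with `Λ y = (c, c̄)`. Its conjugate solves the same system, so the real
  -- part is a real preimage of `c`.
  obtain ⟨y, hy⟩ := LinearMap.range_eq_top.1 htop (Sum.elim c (fun B => star (c B)))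
  have h1 : ∀ B, ∑ i, lam B v i * y i = c B := fun B => congrFun hy (Sum.inl B)
  have h2 : ∀ B, ∑ i, lam B v i * star (y i) = c B := fun B => by
    have : ∑ i, star (lam B v i) * y i = star (c B) := congrFun hy (Sum.inr B)
    simpa using congrArg star this
  refine ⟨fun i => (y i).re, ?_⟩
  funext B
  rw [waveCLM_apply]
  have hre : ∀ i, ((y i).re : ℂ) = (y i + star (y i)) / 2 := fun i => Complex.re_eq_add_conj _
  have : ∀ i, lam B v i * ((y i).re : ℂ)
      = (lam B v i * y i + lam B v i * star (y i)) / 2 := fun i => by rw [hre]; ring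
  simp_rw [this]
  rw [← Finset.sum_div, Finset.sum_add_distrib, h1, h2]
  ring

theorem apply_eq_sum_single (T : (Fin p → ℝ) →L[ℝ] (Fin q → ℝ)) (x : Fin p → ℝ) (α : Fin q) :
    T x α = ∑ i, x i * T (Pi.single i 1) α := by
  conv_lhs => rw [pi_eq_sum_univ' x]
  simp [Finset.sum_apply]

/-- The invariance conditions at a point: the differential vanishes on the common real kernel of
the wave vectors. -/
theorem orthogonal_iff_ker_le (hΛ : LinearIndependent ℂ (fun s => waveMatrix lam v s))
    (hξ : IsOrthogonalFrame lam ξ U) (hv : v ∈ U) (T : (Fin p → ℝ) →L[ℝ] (Fin q → ℝ)) :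
    (∀ a α, ∑ i, ξ a v i * (T (Pi.single i 1) α : ℂ) = 0) ↔
      ∀ x, waveCLM lam v x = 0 → T x = 0 := by
  constructor
  · intro h x hx
    obtain ⟨t, ht⟩ := mem_span_of_orthogonal (hξ.independent v hv) hΛ (card_sum_add_sub hΛ)
      (fun i j => hξ.waveMatrix_orthogonal hv j i) ((waveCLM_eq_zero_iff x).1 hx)
    funext α
    rw [Pi.zero_apply, ← Complex.ofReal_eq_zero, apply_eq_sum_single]
    have hx' : ∀ i, (x i : ℂ) = ∑ a, t a * ξ a v i := fun i => by
      have := congrFun ht i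
      simpa [Finset.sum_apply] using this.symm
    push_cast
    simp_rw [hx', Finset.sum_mul]
    rw [Finset.sum_comm]
    refine Finset.sum_eq_zero fun a _ => ?_
    rw [← mul_zero (t a), ← h a α, Finset.mul_sum]
    exact Finset.sum_congr rfl fun i _ => by ring
  · intro h a α
    have h1 : ∀ B, ∑ i, lam B v i * ξ a v i = 0 := fun B => hξ.orthogonal v hv B a
    have h2 : ∀ B, ∑ i, lam B v i * star (ξ a v i) = 0 := fun B => by
      simpa using congrArg star (hξ.orthogonal_conj v hv B a)
    -- Orthogonality to `λ` and to its conjugate places both the real and the imaginary part of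
    -- `ξ_a` in the real kernel.
    have hre : waveCLM lam v (fun i => (ξ a v i).re) = 0 := by
      funext B
      rw [waveCLM_apply, Pi.zero_apply]
      have : ∀ i, lam B v i * ((ξ a v i).re : ℂ)
          = (lam B v i * ξ a v i + lam B v i * star (ξ a v i)) / 2 := fun i => by
        rw [Complex.re_eq_add_conj]; simp only [starRingEnd_apply]; ring
      simp_rw [this]
      rw [← Finset.sum_div, Finset.sum_add_distrib, h1, h2]
      simp
    have him : waveCLM lam v (fun i => (ξ a v i).im) = 0 := by
      funext B
      rw [waveCLM_apply, Pi.zero_apply]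
      have : ∀ i, lam B v i * ((ξ a v i).im : ℂ)
          = (lam B v i * ξ a v i - lam B v i * star (ξ a v i)) / (2 * Complex.I) := fun i => by
        rw [Complex.im_eq_sub_conj]; simp only [starRingEnd_apply]; ring
      simp_rw [this]
      rw [← Finset.sum_div, Finset.sum_sub_distrib, h1, h2]
      simp
    have r1 := congrFun (h _ hre) α
    have r2 := congrFun (h _ him) α
    rw [apply_eq_sum_single] at r1 r2
    apply Complex.ext
    · simpa using r1
    · simpa using r2

/-- The linear map `(x^i ∂λ^B_i/∂u^β)` at `v`. -/
def waveVariation (lam : Fin k → (Fin q → ℝ) → (Fin p → ℂ)) (x : Fin p → ℝ) (v : Fin q → ℝ) :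
    (Fin q → ℝ) →L[ℝ] (Fin k → ℂ) :=
  ∑ i, x i • fderiv ℝ (fun w B => lam B w i) v

theorem IsWaveSystem.contDiffOn_column (hlam : IsWaveSystem A lam U) (i : Fin p) :
    ContDiffOn ℝ ∞ (fun w B => lam B w i) U :=
  contDiffOn_pi.2 fun B => hlam.contDiffOn_apply B i

theorem riemannInvariant_eq_sum (x : Fin p → ℝ) (v : Fin q → ℝ) :
    riemannInvariant lam x v = ∑ i, x i • fun B => lam B v i := by
  funext B
  simp [riemannInvariant, Finset.sum_apply, mul_comm]

variable {u : (Fin p → ℝ) → (Fin q → ℝ)} {D : Set (Fin p → ℝ)}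

theorem contDiffOn_riemannInvariant (hlam : IsWaveSystem A lam U)
    (hu : ContDiffOn ℝ ∞ u D) (huU : MapsTo u D U) :
    ContDiffOn ℝ ∞ (fun x => riemannInvariant lam x (u x)) D := by
  simp_rw [riemannInvariant_eq_sum]
  refine ContDiffOn.sum fun i _ => ?_
  exact (contDiff_apply ℝ ℝ i).contDiffOn.smul ((hlam.contDiffOn_column i).comp hu huU)

theorem hasFDerivAt_riemannInvariant (hU : IsOpen U) (hlam : IsWaveSystem A lam U)
    (hD : IsOpen D) (hu : ContDiffOn ℝ ∞ u D) (huU : MapsTo u D U) {x : Fin p → ℝ} (hx : x ∈ D) :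
    HasFDerivAt (fun x => riemannInvariant lam x (u x))
      (waveCLM lam (u x) + (waveVariation lam x (u x)).comp (fderiv ℝ u x)) x := by
  simp_rw [riemannInvariant_eq_sum]
  have h : HasFDerivAt (fun x => ∑ i, x i • fun B => lam B (u x) i) _ x :=
    HasFDerivAt.fun_sum fun i _ => (hasFDerivAt_apply i x).smul
      ((differentiableAt_of_contDiffOn hU (hlam.contDiffOn_column i) (huU hx)).hasFDerivAt.comp x
        (differentiableAt_of_contDiffOn hD hu hx).hasFDerivAt)
  refine h.congr_fderiv (ContinuousLinearMap.ext fun w => funext fun B => ?_)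
  simp only [_root_.add_apply, Pi.add_apply, waveCLM_apply, waveVariation, _root_.sum_apply,
    ContinuousLinearMap.comp_apply, Finset.sum_add_distrib, Finset.sum_apply,
    ContinuousLinearMap.smulRight_apply, Pi.smul_apply, _root_.smul_apply,
    ContinuousLinearMap.proj_apply, Complex.real_smul]
  rw [add_comm]
  congr 1
  exact Finset.sum_congr rfl fun i _ => mul_comm _ _

/-- The implicit part of `dr` disappears at `x = 0`. Both directions of the equivalence start from
this: it makes `r` a submersion at the origin, and it makes the correction term small near it. -/
theorem waveVariation_zero : waveVariation lam 0 v = 0 :=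
  Finset.sum_eq_zero fun i _ => zero_smul ℝ (fderiv ℝ (fun w B => lam B w i) v)

/-- A map invariant under the fields `X_a` is a function of the Riemann invariants. -/
theorem isModeFormOn_of_isInvariantOn (hU : IsOpen U) (hlam : IsWaveSystem A lam U)
    (hξ : IsOrthogonalFrame lam ξ U) (hD : IsOpen D) (h0 : (0 : Fin p → ℝ) ∈ D)
    (hu : ContDiffOn ℝ ∞ u D) (huU : MapsTo u D U)
    (h : ∃ V ∈ 𝓝 (0 : Fin p → ℝ), V ⊆ D ∧ IsInvariantOn ξ u V) :
    ∃ V ∈ 𝓝 (0 : Fin p → ℝ), V ⊆ D ∧ IsModeFormOn lam u V := by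
  obtain ⟨V, hV, hVD, hinv⟩ := h
  have hfd := fun x hx => (hasFDerivAt_riemannInvariant hU hlam hD hu huU (x := x) hx).fderiv
  have hsurj : Function.Surjective (fderiv ℝ (fun x => riemannInvariant lam x (u x)) 0) := by
    rw [hfd 0 h0]
    rw [waveVariation_zero, ContinuousLinearMap.zero_comp, add_zero]
    exact waveCLM_surjective (hlam.independent _ (huU h0))
  have hker : ∀ᶠ x in 𝓝 (0 : Fin p → ℝ),
      Function.Surjective (fderiv ℝ (fun x => riemannInvariant lam x (u x)) x) →
      ∀ w, fderiv ℝ (fun x => riemannInvariant lam x (u x)) x w = 0 → fderiv ℝ u x w = 0 := by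
    filter_upwards [hV] with x hx hs w hw
    have hΛ := hlam.independent _ (huU (hVD hx))
    have hT := (orthogonal_iff_ker_le hΛ hξ (huU (hVD hx)) (fderiv ℝ u x)).1 (hinv x hx)
    set R := fderiv ℝ (fun x => riemannInvariant lam x (u x)) x with hR
    -- One inclusion is enough: both maps are onto `ℂ^k`, so their kernels have equal dimension.
    have hle : LinearMap.ker (waveCLM lam (u x) : (Fin p → ℝ) →ₗ[ℝ] (Fin k → ℂ))
        ≤ LinearMap.ker (R : (Fin p → ℝ) →ₗ[ℝ] (Fin k → ℂ)) := by
      intro y hy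
      have hy' : waveCLM lam (u x) y = 0 := hy
      change R y = 0
      rw [hR, hfd x (hVD hx)]
      simp [hy', hT y hy']
    have e1 := LinearMap.finrank_range_add_finrank_ker
      (waveCLM lam (u x) : (Fin p → ℝ) →ₗ[ℝ] (Fin k → ℂ))
    have e2 := LinearMap.finrank_range_add_finrank_ker (R : (Fin p → ℝ) →ₗ[ℝ] (Fin k → ℂ))
    rw [LinearMap.range_eq_top.2 (waveCLM_surjective hΛ)] at e1
    rw [LinearMap.range_eq_top.2 hs] at e2
    have heq := Submodule.eq_of_le_of_finrank_eq hle (by omega)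
    have hwker : w ∈ LinearMap.ker (R : (Fin p → ℝ) →ₗ[ℝ] (Fin k → ℂ)) := hw
    rw [← heq] at hwker
    exact hT w hwker
  obtain ⟨O, g, hO, hg, hgu⟩ := exists_factor_through_submersion hD
    (contDiffOn_riemannInvariant hlam hu huU) hu h0 hsurj hker
  -- The profile is half of the real factor `g`, so adding the complex conjugate restores `g`.
  refine ⟨D ∩ {x | riemannInvariant lam x (u x) ∈ O ∧ u x = g (riemannInvariant lam x (u x))},
    Filter.inter_mem (hD.mem_nhds h0) hgu, inter_subset_left, O, fun c α => (g c α : ℂ) / 2, hO,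
    ?_, ?_⟩
  · refine contDiffOn_pi.2 fun α => ?_
    exact (Complex.ofRealCLM.contDiff.comp_contDiffOn (contDiffOn_pi.1 hg α)).div_const 2
  · rintro x ⟨-, hxO, hxu⟩
    refine ⟨hxO, fun α => ?_⟩
    change (u x α : ℂ) = (g (riemannInvariant lam x (u x)) α : ℂ) / 2
      + star ((g (riemannInvariant lam x (u x)) α : ℂ) / 2)
    rw [← hxu]
    simp

/-- A function of the Riemann invariants is invariant under the fields `X_a`. -/
theorem isInvariantOn_of_isModeFormOn (hU : IsOpen U) (hlam : IsWaveSystem A lam U)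
    (hξ : IsOrthogonalFrame lam ξ U) (hD : IsOpen D) (h0 : (0 : Fin p → ℝ) ∈ D)
    (hu : ContDiffOn ℝ ∞ u D) (huU : MapsTo u D U)
    (h : ∃ V ∈ 𝓝 (0 : Fin p → ℝ), V ⊆ D ∧ IsModeFormOn lam u V) :
    ∃ V ∈ 𝓝 (0 : Fin p → ℝ), V ⊆ D ∧ IsInvariantOn ξ u V := by
  obtain ⟨V, hV, hVD, O, f, hO, hf, hfu⟩ := h
  set r : (Fin p → ℝ) → (Fin k → ℂ) := fun x => riemannInvariant lam x (u x) with hr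
  set g : (Fin k → ℂ) → (Fin q → ℝ) := fun c α => 2 * (f c α).re with hg
  have hgs : ContDiffOn ℝ ∞ g O := contDiffOn_pi.2 fun α =>
    contDiffOn_const.mul (Complex.reCLM.contDiff.comp_contDiffOn (contDiffOn_pi.1 hf α))
  have hug : ∀ x ∈ V, u x = g (r x) := fun x hx => by
    funext α
    have := congrArg Complex.re ((hfu x hx).2 α)
    simp only [Complex.ofReal_re, Complex.add_re] at this
    rw [this, hg]
    simp [two_mul, hr]
  have hrD := contDiffOn_riemannInvariant hlam hu huU
  have hcu : ContinuousAt u 0 := (hu.contDiffAt (hD.mem_nhds h0)).continuousAt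
  have hcr : ContinuousAt r 0 := (hrD.contDiffAt (hD.mem_nhds h0)).continuousAt
  have hcM : ContinuousAt (fun x => waveVariation lam x (u x)) 0 := by
    unfold waveVariation
    refine tendsto_finsetSum _ fun i _ => ?_
    refine (continuous_apply i).continuousAt.smul ?_
    exact ContinuousAt.comp (g := fderiv ℝ (fun w B => lam B w i))
      ((((hlam.contDiffOn_column i).contDiffAt (hU.mem_nhds (huU h0))).fderiv_right (m := 0)
        (by simp)).continuousAt) hcu
  have hr0 : r 0 ∈ O := (hfu 0 (mem_of_mem_nhds hV)).1
  have hcg : ContinuousAt (fun x => fderiv ℝ g (r x)) 0 :=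
    ContinuousAt.comp (g := fderiv ℝ g)
      (((hgs.contDiffAt (hO.mem_nhds hr0)).fderiv_right (m := 0) (by simp)).continuousAt) hcr
  have hsmall : ∀ᶠ x in 𝓝 (0 : Fin p → ℝ),
      ‖(fderiv ℝ g (r x)).comp (waveVariation lam x (u x))‖ < 1 := by
    have hc : ContinuousAt
        (fun x => ‖(fderiv ℝ g (r x)).comp (waveVariation lam x (u x))‖) 0 :=
      (hcg.clm_comp hcM).norm
    refine hc.eventually_lt continuousAt_const ?_
    rw [waveVariation_zero]
    simp
  -- The relation `u = g(r)` is differentiated, so it must hold around each point; hence the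
  -- interior.
  refine ⟨interior V ∩ {x | ‖(fderiv ℝ g (r x)).comp (waveVariation lam x (u x))‖ < 1},
    Filter.inter_mem (interior_mem_nhds.2 hV) hsmall,
    inter_subset_left.trans (interior_subset.trans hVD), ?_⟩
  rintro x ⟨hxV, hx1⟩
  have hxD : x ∈ D := hVD (interior_subset hxV)
  refine (orthogonal_iff_ker_le (hlam.independent _ (huU hxD)) hξ (huU hxD)
    (fderiv ℝ u x)).2 fun w hw => ?_
  have hrd := hasFDerivAt_riemannInvariant hU hlam hD hu huU hxD
  have hgd := (differentiableAt_of_contDiffOn hO hgs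
    (hfu x (interior_subset hxV)).1).hasFDerivAt
  have hud : HasFDerivAt u _ x := (hgd.comp x hrd).congr_of_eventuallyEq (by
    filter_upwards [isOpen_interior.mem_nhds hxV] with y hy using hug y (interior_subset hy))
  -- For `w` in the kernel of the wave vectors, `dr w` reduces to its implicit part, so `du w` is a
  -- fixed point of an operator of norm less than one.
  have heq : fderiv ℝ u x w
      = ((fderiv ℝ g (r x)).comp (waveVariation lam x (u x))) (fderiv ℝ u x w) := by
    conv_lhs => rw [hud.fderiv]
    simp [hw, hr]
  by_contra hne
  have hpos : 0 < ‖fderiv ℝ u x w‖ := norm_pos_iff.2 hne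
  have hle := ((fderiv ℝ g (r x)).comp (waveVariation lam x (u x))).le_opNorm (fderiv ℝ u x w)
  rw [← heq] at hle
  exact hle.not_gt ((mul_lt_iff_lt_one_left hpos).2 hx1)

end Modes

end QuasilinearSystem

end

theorem proposition2 {p q m k : ℕ}
    (A : Fin p → (Fin q → ℝ) → Matrix (Fin m) (Fin q) ℝ)
    (U : Set (Fin q → ℝ)) (hU : IsOpen U)
    (hA : ∀ i μ α, ContDiffOn ℝ ∞ (fun u => A i u μ α) U)
    (lam : Fin k → (Fin q → ℝ) → (Fin p → ℂ))
    (hlam : QuasilinearSystem.IsWaveSystem A lam U)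
    (ξ : Fin (p - 2 * k) → (Fin q → ℝ) → (Fin p → ℂ))
    (hξ : QuasilinearSystem.IsOrthogonalFrame lam ξ U)
    (hnondeg : ∀ z ∈ QuasilinearSystem.SDelta A U ∩ QuasilinearSystem.SQ ξ,
      QuasilinearSystem.IsNondegenerateAt A U z) :
    (∀ (x₀ : Fin p → ℝ), ∀ u₀ ∈ U, ∀ M : ℕ, M = q ∨ M = 2 * k →
      (QuasilinearSystem.GeneratesSymmetryAlgebraNear A U ξ (x₀, u₀) ↔
        QuasilinearSystem.TraceConditionsNear M A lam U ξ (x₀, u₀)) ∧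
      (QuasilinearSystem.AdmitsSymmetryAlgebraNear A lam U (x₀, u₀) ↔
        QuasilinearSystem.TraceConditionsNear M A lam U ξ (x₀, u₀))) ∧
    (∀ (D : Set (Fin p → ℝ)) (u : (Fin p → ℝ) → (Fin q → ℝ)), IsOpen D → 0 ∈ D →
      QuasilinearSystem.IsSolutionOn A U u D →
      ((∃ V ∈ 𝓝 (0 : Fin p → ℝ), V ⊆ D ∧ QuasilinearSystem.IsInvariantOn ξ u V) ↔
        (∃ V ∈ 𝓝 (0 : Fin p → ℝ), V ⊆ D ∧ QuasilinearSystem.IsModeFormOn lam u V))) := by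
  refine ⟨fun x₀ u₀ hu₀ M hM => ?_, fun D u hD h0 hu => ?_⟩
  · rw [QuasilinearSystem.traceConditionsNear_iff hM hlam hξ,
      QuasilinearSystem.generatesSymmetryAlgebraNear_iff hU hA hlam hξ,
      QuasilinearSystem.admitsSymmetryAlgebraNear_iff hU hA hlam hξ hu₀]
    exact ⟨Iff.rfl, Iff.rfl⟩
  · exact ⟨QuasilinearSystem.isModeFormOn_of_isInvariantOn hU hlam hξ hD h0 hu.smooth hu.mapsTo,
      QuasilinearSystem.isInvariantOn_of_isModeFormOn hU hlam hξ hD h0 hu.smooth hu.mapsTo⟩
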